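/- Fix the alphabet $\Sigma=\{0,1\}$; a set means a set $L\subseteq\Sigma^*$, and polynomial time means deterministic Turing machine time polynomial in the length of the input. $\mathrm{P}$ is the class of sets whose membership problem is decidable in polynomial time. $\mathrm{SAT}$ is the set of (encodings in $\Sigma^*$, under a standard encoding, of) satisfiable propositional Boolean formulas, built from variables and the constants True and False by $\neg,\wedge,\vee$. Write $A\le_m^p B$ if there is a polynomial-time computable $g:\Sigma^*\to\Sigma^*$ such that, for all $x\in\Sigma^*$, $x\in A\iff g(x)\in B$. Let $\mathrm{NP}=\{L \mid L\le_m^p \mathrm{SAT}\}$. A set $H$ is $\mathrm{NP}$-hard if $L\le_m^p H$ for every $L\in\mathrm{NP}$. A set $L$ is $\mathrm{P}$-selective if there is a polynomial-time computable function $f:\Sigma^*\times\Sigma^*\to\Sigma^*$ such that for all $a,b\in\Sigma^*$, $$f(a,b)\in\{a,b\}\quad\text{and}\quad\bigl(\{a,b\}\cap L\ne\emptyset\implies f(a,b)\in L\bigr).$$ **Theorem.** If there exists an $\mathrm{NP}$-hard, $\mathrm{P}$-selective set, then $\mathrm{P}=\mathrm{NP}$. -/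

import Mathlib

namespace SemiFeasible

/-- Strings over the alphabet `{0, 1}`. -/
abbrev Str : Type := List Bool

/-- Polynomial-time computability on a deterministic multi-tape (stack) Turing machine of a
function whose inputs and outputs are presented through the given encodings as strings over
finite alphabets. -/
def PolyTime {α β Γ Δ : Type} [Fintype Γ] [Fintype Δ]
    (ea : α → List Γ) (eb : β → List Δ) (f : α → β) : Prop :=
  Nonempty (Turing.TM2ComputableInPolyTime ea eb f)

/-- A pair of strings, written as one string over two disjoint copies of `{0, 1}`: the first
component in the first copy, followed by the second component in the second copy. -/
def encodePair : Str × Str → List (Bool ⊕ Bool) :=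
  (Computability.encodingProd (Computability.encodingList Bool)
    (Computability.encodingList Bool)).encode

/-- The class P: sets of strings whose membership problem is decided in polynomial time. -/
def classP : Set (Set Str) :=
  {L | ∃ d : Str → Bool, PolyTime id Computability.encodeBool d ∧ ∀ x, d x = true ↔ x ∈ L}

/-- Many-one polynomial-time reducibility. -/
def ManyOneReduces (A B : Set Str) : Prop :=
  ∃ g : Str → Str, PolyTime id id g ∧ ∀ x, x ∈ A ↔ g x ∈ B

/-- P-selectivity (semi-feasibility). -/
def PSelective (L : Set Str) : Prop :=
  ∃ f : Str × Str → Str, PolyTime encodePair id f ∧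
    ∀ a b : Str, f (a, b) ∈ ({a, b} : Set Str) ∧
      ((({a, b} : Set Str) ∩ L).Nonempty → f (a, b) ∈ L)

/-- Propositional Boolean formulas, with the constants True and False. The variables are
`x_w`, one for each index `w` in `{0, 1}*`. -/
inductive BoolFormula : Type
  | const (b : Bool) : BoolFormula
  | var (w : Str) : BoolFormula
  | neg (φ : BoolFormula) : BoolFormula
  | and (φ ψ : BoolFormula) : BoolFormula
  | or (φ ψ : BoolFormula) : BoolFormula

namespace BoolFormula

/-- The truth value of a formula under an assignment. -/
def eval (v : Str → Bool) : BoolFormula → Bool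
  | const b => b
  | var w => v w
  | neg φ => !(eval v φ)
  | and φ ψ => eval v φ && eval v ψ
  | or φ ψ => eval v φ || eval v ψ

/-- A formula is satisfiable if some truth assignment makes it evaluate to True. -/
def Satisfiable (φ : BoolFormula) : Prop :=
  ∃ v : Str → Bool, eval v φ = true

/-- Self-delimiting code of a variable index: every bit is preceded by a `1`, and a `0` ends
the code. -/
def encodeIndex : Str → Str
  | [] => [false]
  | b :: w => true :: b :: encodeIndex w

/-- The formula as a bit string, in postfix (reverse Polish) notation with three-bit codes for
False, True, "variable", "not", "and", "or". -/
def encode : BoolFormula → Str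
  | const b => [false, false, b]
  | var w => [false, true, false] ++ encodeIndex w
  | neg φ => encode φ ++ [false, true, true]
  | and φ ψ => encode φ ++ encode ψ ++ [true, false, false]
  | or φ ψ => encode φ ++ encode ψ ++ [true, false, true]

/-- Reading off a variable index and the rest of the string. -/
def decodeIndex : Str → Option (Str × Str)
  | false :: r => some ([], r)
  | true :: b :: r => (decodeIndex r).map fun p => (b :: p.1, p.2)
  | _ => none

theorem decodeIndex_encodeIndex (w r : Str) :
    decodeIndex (encodeIndex w ++ r) = some (w, r) := by
  induction w with
  | nil => simp [encodeIndex, decodeIndex]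
  | cons b w ih => simp [encodeIndex, decodeIndex, ih]

/-- Reading a postfix string with a stack of formulas (`n` bounds the number of tokens read). -/
def decodeAux : ℕ → Str → List BoolFormula → Option (List BoolFormula)
  | _, [], S => some S
  | n + 1, false :: false :: b :: r, S => decodeAux n r (const b :: S)
  | n + 1, false :: true :: false :: r, S =>
      (decodeIndex r).bind fun p => decodeAux n p.2 (var p.1 :: S)
  | n + 1, false :: true :: true :: r, φ :: S => decodeAux n r (neg φ :: S)
  | n + 1, true :: false :: false :: r, ψ :: φ :: S => decodeAux n r (and φ ψ :: S)
  | n + 1, true :: false :: true :: r, ψ :: φ :: S => decodeAux n r (or φ ψ :: S)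
  | _, _, _ => none

/-- The number of tokens of a formula. -/
def size : BoolFormula → ℕ
  | const _ => 1
  | var _ => 1
  | neg φ => size φ + 1
  | and φ ψ => size φ + size ψ + 1
  | or φ ψ => size φ + size ψ + 1

theorem decodeAux_encode (φ : BoolFormula) (n : ℕ) (r : Str) (S : List BoolFormula) :
    decodeAux (size φ + n) (encode φ ++ r) S = decodeAux n r (φ :: S) := by
  induction φ generalizing n r S with
  | const b => simp [size, encode, Nat.add_comm 1 n, decodeAux]
  | var w => simp [size, encode, Nat.add_comm 1 n, decodeAux, decodeIndex_encodeIndex]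
  | neg φ ih =>
    simp [size, encode, Nat.add_assoc, Nat.add_comm 1 n, ih, decodeAux]
  | and φ ψ ih₁ ih₂ =>
    simp [size, encode, Nat.add_assoc, Nat.add_comm 1 n, ih₁, ih₂, decodeAux]
  | or φ ψ ih₁ ih₂ =>
    simp [size, encode, Nat.add_assoc, Nat.add_comm 1 n, ih₁, ih₂, decodeAux]

/-- Distinct formulas have distinct codes. -/
theorem encode_injective : Function.Injective encode := by
  intro φ ψ h
  have h₁ := decodeAux_encode φ (size ψ) [] []
  have h₂ := decodeAux_encode ψ (size φ) [] []
  rw [h, Nat.add_comm, h₂] at h₁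
  simpa [decodeAux, eq_comm] using h₁

end BoolFormula

/-- SAT: the set of all (codes of) satisfiable Boolean formulas. -/
def SAT : Set Str :=
  {x | ∃ φ : BoolFormula, φ.encode = x ∧ φ.Satisfiable}

/-- The class NP: the sets that many-one polynomial-time reduce to SAT. -/
def classNP : Set (Set Str) :=
  {L | ManyOneReduces L SAT}

/-- `H` is hard for the class `C`: every set in `C` many-one polynomial-time reduces to `H`. -/
def Hard (C : Set (Set Str)) (H : Set Str) : Prop :=
  ∀ L ∈ C, ManyOneReduces L H

end SemiFeasible

namespace SemiFeasible

open Turing Function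

/-! ## Iterating the step function of a machine -/

/-! SAT is self-reducible: φ is satisfiable iff φ[w:=0] or φ[w:=1] is
(`BoolFormula.satisfiable_iff_subst`). Let g reduce SAT to the hard set H and let f be the selector
of H. If φ is satisfiable, then g maps one of the two substituted codes into H, so f, applied to the
two images, returns an element of H, and the substitution with that image is satisfiable. Thus f
prunes the search tree to a single path: each step keeps an equisatisfiable formula
(`Prog.satisfiable_iff_select`), and the path ends in a formula without variables, whose value is
the answer. Substitution never lengthens a code (`BoolFormula.length_encode_subst_le`), so all
queries have polynomial size. Applied to the image of x under a reduction to SAT, this decides any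
set in NP. Conversely, P lies in NP by sending x to the constant formula that states whether x is in
the set.

The rest is a Turing machine for this procedure. It is written in a small language of programs on
bit registers with subroutine calls. Compiled code simulates a program with exactly the same running
time (`Prog.stepsTo_code`), and `Prog.polyTime_of_exec` turns time bounds for programs into
polynomial-time computability. The functions given by the hypotheses become subroutines
(`PolyTime.exists_sub`); their output lengths are bounded through their running times, which makes
composition polynomial.

A postfix code is a concatenation of token codes, so substitution and evaluation are single passes
over the string. Evaluation also serves as the syntax check, which is needed because a reduction may
produce strings that code no formula. -/

theorem iterate_bind_none {C : Type*} (f : C → Option C) (n : ℕ) :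
    (flip bind f)^[n] none = none := by
  induction n with
  | zero => rfl
  | succ n ih => rw [iterate_succ_apply]; exact ih

/-- The configuration `d` is reached from `c` in exactly `n` steps. -/
def StepsTo {C : Type*} (f : C → Option C) (n : ℕ) (c d : C) : Prop :=
  (flip bind f)^[n] (some c) = some d

namespace StepsTo

variable {C : Type*} {f : C → Option C} {c d e : C} {m n : ℕ}

theorem refl (c : C) : StepsTo f 0 c c := rfl

theorem single (h : f c = some d) : StepsTo f 1 c d := h

theorem trans (h₁ : StepsTo f m c d) (h₂ : StepsTo f n d e) : StepsTo f (m + n) c e := by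
  unfold StepsTo at *
  rw [Nat.add_comm, iterate_add_apply, h₁, h₂]

theorem succ_iff : StepsTo f (n + 1) c e ↔ ∃ d, f c = some d ∧ StepsTo f n d e := by
  unfold StepsTo
  rw [iterate_succ_apply]
  change (flip bind f)^[n] (f c) = _ ↔ _
  cases h : f c with
  | none => rw [iterate_bind_none]; simp
  | some d => simp

end StepsTo

/-! ## Polynomial-time machines as subroutines -/

/-- Replaces the type cast inside `initList` by `update`, the form in which all stack contents are
handled below. -/
theorem initList_stk (tm : FinTM2) (w : List (tm.Γ tm.k₀)) :
    (initList tm w).stk = update (fun _ => []) tm.k₀ w := by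
  funext k
  by_cases h : k = tm.k₀
  · subst h; simp [initList]
  · simp [initList, h]

theorem haltList_stk (tm : FinTM2) (w : List (tm.Γ tm.k₁)) :
    (haltList tm w).stk = update (fun _ => []) tm.k₁ w := by
  funext k
  by_cases h : k = tm.k₁
  · subst h; simp [haltList]
  · simp [haltList, h]

/-- A machine that is fed from two registers of bits, the contents of which are written with
possibly different symbols, and the output of which is read as a string of bits. -/
structure Sub where
  /-- the machine -/
  tm : FinTM2
  /-- the symbols for the bits of the first register -/
  inA : Bool → tm.Γ tm.k₀
  /-- the symbols for the bits of the second register -/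
  inB : Bool → tm.Γ tm.k₀
  /-- the bit meant by an output symbol -/
  out : tm.Γ tm.k₁ → Bool

/-- On the input `u`, `v` the machine halts after `t` steps with output `w`. -/
def Sub.Outputs (S : Sub) (u v : Str) (w : Str) (t : ℕ) : Prop :=
  ∃ y, y.map S.out = w ∧
    StepsTo S.tm.step t (initList S.tm (u.map S.inA ++ v.map S.inB)) (haltList S.tm y)

/-! ## Programs on registers of bits -/

/-- Structured programs on registers of bits, which are stacks. -/
inductive Prog (R I : Type) : Type
  /-- do nothing -/
  | skip : Prog R I
  /-- push a bit -/
  | push (r : R) (b : Bool) : Prog R I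
  /-- pop a bit and branch on it, with a third branch for the empty register -/
  | cases (r : R) (p₀ p₁ pn : Prog R I) : Prog R I
  /-- one program after the other -/
  | seq (p q : Prog R I) : Prog R I
  /-- as long as the register is nonempty, pop a bit and branch on it -/
  | loop (r : R) (p₀ p₁ : Prog R I) : Prog R I
  /-- run a subroutine on the reversals of two registers and push the output -/
  | call (i : I) (a b o : R) : Prog R I

namespace Prog

variable {R I : Type} (S : I → Sub)

/-- Big-step semantics, with the running time. -/
inductive Exec [DecidableEq R] : Prog R I → (R → Str) → (R → Str) → ℕ → Prop
  | skip (s) : Exec skip s s 1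
  | push (r b s) : Exec (push r b) s (update s r (b :: s r)) 1
  | cases_nil {r p₀ p₁ pn s s' t} : s r = [] → Exec pn s s' t →
      Exec (cases r p₀ p₁ pn) s s' (t + 1)
  | cases_false {r p₀ p₁ pn s s' t l} : s r = false :: l → Exec p₀ (update s r l) s' t →
      Exec (cases r p₀ p₁ pn) s s' (t + 1)
  | cases_true {r p₀ p₁ pn s s' t l} : s r = true :: l → Exec p₁ (update s r l) s' t →
      Exec (cases r p₀ p₁ pn) s s' (t + 1)
  | seq {p q s s' s'' t t'} : Exec p s s' t → Exec q s' s'' t' → Exec (seq p q) s s'' (t + t')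
  | loop_nil {r p₀ p₁ s} : s r = [] → Exec (loop r p₀ p₁) s s 1
  | loop_false {r p₀ p₁ s s' s'' t t' l} : s r = false :: l → Exec p₀ (update s r l) s' t →
      Exec (loop r p₀ p₁) s' s'' t' → Exec (loop r p₀ p₁) s s'' (1 + t + t')
  | loop_true {r p₀ p₁ s s' s'' t t' l} : s r = true :: l → Exec p₁ (update s r l) s' t →
      Exec (loop r p₀ p₁) s' s'' t' → Exec (loop r p₀ p₁) s s'' (1 + t + t')
  -- Each move costs one step per symbol and one to notice the empty stack. Moving reverses, hence
  -- the reversals. If `a = b`, the first move would already empty the other argument.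
  | call {i a b o s w t} : a ≠ b → (S i).Outputs (s a).reverse (s b).reverse w t →
      Exec (call i a b o) s
        (update (update (update s b []) a []) o
          (w.reverse ++ update (update s b []) a [] o))
        (((s b).length + 1) + ((s a).length + 1) + t + (w.length + 1))

/-! ### Compilation -/

/-- The labels of the machine code of a program. -/
def Lab : Prog R I → Type
  | skip => Unit
  | push _ _ => Unit
  | cases _ p₀ p₁ pn => Option (Lab p₀ ⊕ Lab p₁ ⊕ Lab pn)
  | seq p q => Lab p ⊕ Lab q
  | loop _ p₀ p₁ => Option (Lab p₀ ⊕ Lab p₁)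
  | call i _ _ _ => Fin 3 ⊕ (S i).tm.Λ

/-- There are finitely many labels. -/
@[reducible]
def fintypeLab : (p : Prog R I) → Fintype (Lab S p)
  | skip => inferInstanceAs (Fintype Unit)
  | push _ _ => inferInstanceAs (Fintype Unit)
  | cases _ p₀ p₁ pn =>
    haveI := fintypeLab p₀; haveI := fintypeLab p₁; haveI := fintypeLab pn
    inferInstanceAs (Fintype (Option (Lab S p₀ ⊕ Lab S p₁ ⊕ Lab S pn)))
  | seq p q =>
    haveI := fintypeLab p; haveI := fintypeLab q
    inferInstanceAs (Fintype (Lab S p ⊕ Lab S q))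
  | loop _ p₀ p₁ =>
    haveI := fintypeLab p₀; haveI := fintypeLab p₁
    inferInstanceAs (Fintype (Option (Lab S p₀ ⊕ Lab S p₁)))
  | call i _ _ _ =>
    haveI := (S i).tm.ΛFin
    inferInstanceAs (Fintype (Fin 3 ⊕ (S i).tm.Λ))

/-- The label at which the machine code of a program starts. -/
def entry : (p : Prog R I) → Lab S p
  | skip => ()
  | push _ _ => ()
  | cases _ _ _ _ => none
  | seq p _ => Sum.inl (entry p)
  | loop _ _ _ => none
  | call _ _ _ _ => Sum.inl 0

variable (R) in
/-- The stacks of the compiled machine: the registers and the stacks of all subroutines. -/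
abbrev Stack : Type := R ⊕ Σ i, (S i).tm.K

variable (R) in
/-- The alphabets of the stacks of the compiled machine. -/
abbrev Alph : Stack R S → Type
  | .inl _ => Bool
  | .inr k => (S k.1).tm.Γ k.2

/-- The internal states of the compiled machine: a buffer and the states of all subroutines. -/
abbrev St : Type := Option Bool × ∀ i, (S i).tm.σ

/-- The initial states of all subroutines. -/
abbrev init : ∀ i, (S i).tm.σ := fun i => (S i).tm.initialState

/-- The contents of all stacks. -/
def stks (s : R → Str) (c : ∀ i k, List ((S i).tm.Γ k)) : ∀ k, List (Alph R S k)
  | .inl r => s r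
  | .inr k => c k.1 k.2

@[simp] theorem stks_inl (s : R → Str) (c : ∀ i k, List ((S i).tm.Γ k)) (r : R) :
    stks S s c (.inl r) = s r := rfl

@[simp] theorem stks_inr (s : R → Str) (c : ∀ i k, List ((S i).tm.Γ k)) (k : Σ i, (S i).tm.K) :
    stks S s c (.inr k) = c k.1 k.2 := rfl

/-- All stacks of the subroutines are empty. -/
abbrev noStk : ∀ i k, List ((S i).tm.Γ k) := fun _ _ => []

/-- Pop a bit into the buffer, then jump. -/
def popGoto {Λ : Type} (r : R) (g : Option Bool → Λ) : TM2.Stmt (Alph R S) Λ (St S) :=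
  .pop (.inl r) (fun v x => (x, v.2)) (.goto fun v => g v.1)

variable [DecidableEq I]

/-- A statement of a subroutine as a statement of the whole machine. -/
def liftStmt {Λ : Type} (i : I) (run : (S i).tm.Λ → Λ) (fin : Λ) :
    TM2.Stmt (S i).tm.Γ (S i).tm.Λ (S i).tm.σ → TM2.Stmt (Alph R S) Λ (St S)
  | .push k f q => .push (.inr ⟨i, k⟩) (fun v => f (v.2 i)) (liftStmt i run fin q)
  | .peek k f q =>
    .peek (.inr ⟨i, k⟩) (fun v x => (v.1, update v.2 i (f (v.2 i) x))) (liftStmt i run fin q)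
  | .pop k f q =>
    .pop (.inr ⟨i, k⟩) (fun v x => (v.1, update v.2 i (f (v.2 i) x))) (liftStmt i run fin q)
  | .load f q => .load (fun v => (v.1, update v.2 i (f (v.2 i)))) (liftStmt i run fin q)
  | .branch f q₁ q₂ =>
    .branch (fun v => f (v.2 i)) (liftStmt i run fin q₁) (liftStmt i run fin q₂)
  | .goto l => .goto fun v => run (l (v.2 i))
  | .halt => .goto fun _ => fin

/-- The code that moves a register to the input stack of a subroutine. -/
def copyIn {Λ : Type} (i : I) (r : R) (f : Bool → (S i).tm.Γ (S i).tm.k₀) (self next : Λ) :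
    TM2.Stmt (Alph R S) Λ (St S) :=
  .pop (.inl r) (fun v x => (x, v.2))
    (.branch (fun v => v.1.isSome)
      (.push (.inr ⟨i, (S i).tm.k₀⟩) (fun v => f (v.1.getD false)) (.goto fun _ => self))
      (.goto fun _ => next))

/-- The code that moves the output stack of a subroutine to a register. -/
def copyOut {Λ : Type} (i : I) (r : R) (self next : Λ) : TM2.Stmt (Alph R S) Λ (St S) :=
  .pop (.inr ⟨i, (S i).tm.k₁⟩) (fun v x => (x.map (S i).out, v.2))
    (.branch (fun v => v.1.isSome)
      (.push (.inl r) (fun v => v.1.getD false) (.goto fun _ => self))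
      (.goto fun _ => next))

/-- The machine code of a program, whose labels are placed by `e`, and which ends by jumping to
the label `x`. -/
def code {Λ : Type} : (p : Prog R I) → (Lab S p → Λ) → Λ → Lab S p → TM2.Stmt (Alph R S) Λ (St S)
  | skip, _, x, _ => .goto fun _ => x
  | push r b, _, x, _ => .push (.inl r) (fun _ => b) (.goto fun _ => x)
  | cases r p₀ p₁ pn, e, _, none =>
    popGoto S r fun
      | some false => e (some (.inl (entry S p₀)))
      | some true => e (some (.inr (.inl (entry S p₁))))
      | none => e (some (.inr (.inr (entry S pn))))
  | cases _ p₀ _ _, e, x, some (.inl l) => code p₀ (fun l => e (some (.inl l))) x l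
  | cases _ _ p₁ _, e, x, some (.inr (.inl l)) => code p₁ (fun l => e (some (.inr (.inl l)))) x l
  | cases _ _ _ pn, e, x, some (.inr (.inr l)) => code pn (fun l => e (some (.inr (.inr l)))) x l
  | seq p q, e, _, .inl l => code p (fun l => e (.inl l)) (e (.inr (entry S q))) l
  | seq _ q, e, x, .inr l => code q (fun l => e (.inr l)) x l
  | loop r p₀ p₁, e, x, none =>
    popGoto S r fun
      | some false => e (some (.inl (entry S p₀)))
      | some true => e (some (.inr (entry S p₁)))
      | none => x
  | loop _ p₀ _, e, _, some (.inl l) => code p₀ (fun l => e (some (.inl l))) (e none) l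
  | loop _ _ p₁, e, _, some (.inr l) => code p₁ (fun l => e (some (.inr l))) (e none) l
  -- Register `b` is moved first, so that its symbols end up below those of `a` on the input stack.
  | call i _ b _, e, _, .inl 0 => copyIn S i b (S i).inB (e (.inl 0)) (e (.inl 1))
  | call i a _ _, e, _, .inl 1 => copyIn S i a (S i).inA (e (.inl 1)) (e (.inr (S i).tm.main))
  | call i _ _ o, e, x, .inl 2 => copyOut S i o (e (.inl 2)) x
  | call i _ _ _, e, _, .inr l =>
    liftStmt S i (fun l => e (.inr l)) (e (.inl 2)) ((S i).tm.m l)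

end Prog

/-! ### Correctness of the compilation -/

namespace Prog

variable {R I : Type} [DecidableEq R] (S : I → Sub) [DecidableEq I]

theorem update_stks_inl (s : R → Str) (c : ∀ i k, List ((S i).tm.Γ k)) (r : R) (l : Str) :
    update (stks S s c) (.inl r) l = stks S (update s r l) c := by
  funext k
  rcases k with r' | k
  · by_cases h : r' = r
    · subst h; simp
    · simp [ h]
  · simp

theorem update_stks_inr (s : R → Str) (c : ∀ i k, List ((S i).tm.Γ k)) (i : I) (k : (S i).tm.K)
    (l : List ((S i).tm.Γ k)) :
    update (stks S s c) (.inr ⟨i, k⟩) l = stks S s (update c i (update (c i) k l)) := by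
  funext k'
  rcases k' with r' | ⟨i', k'⟩
  · simp
  · by_cases h : i' = i
    · subst h
      by_cases h' : k' = k
      · subst h'; simp
      · have : (⟨i', k'⟩ : Σ i, (S i).tm.K) ≠ ⟨i', k⟩ := by simpa using h'
        simp [ h', this]
    · have : (⟨i', k'⟩ : Σ i, (S i).tm.K) ≠ ⟨i, k⟩ := fun e => h (congrArg Sigma.fst e)
      simp [ h, this]

variable {S} {Λ : Type} (M : Λ → TM2.Stmt (Alph R S) Λ (St S))

/-- A configuration of the compiled machine in which no subroutine is running. -/
abbrev cfg (l : Λ) (b : Option Bool) (s : R → Str) : TM2.Cfg (Alph R S) Λ (St S) :=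
  ⟨some l, (b, init S), stks S s (noStk S)⟩

/-- A configuration of the compiled machine in which a subroutine is running. -/
abbrev runCfg (i : I) (run : (S i).tm.Λ → Λ) (fin : Λ) (b : Option Bool) (s : R → Str)
    (c : (S i).tm.Cfg) : TM2.Cfg (Alph R S) Λ (St S) :=
  ⟨some (c.l.elim fin run), (b, update (init S) i c.var), stks S s (update (noStk S) i c.stk)⟩

/-- A lifted statement touches only the stacks and the state of subroutine `i`; halting becomes a
jump to `fin`. One step of the subroutine is therefore exactly one step of the whole machine. -/
theorem stepAux_liftStmt (i : I) (run : (S i).tm.Λ → Λ) (fin : Λ) (b : Option Bool) (s : R → Str)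
    (q : TM2.Stmt (S i).tm.Γ (S i).tm.Λ (S i).tm.σ) (v : (S i).tm.σ)
    (c : ∀ k, List ((S i).tm.Γ k)) :
    TM2.stepAux (liftStmt S i run fin q) (b, update (init S) i v)
        (stks S s (update (noStk S) i c)) =
      runCfg i run fin b s (TM2.stepAux q v c) := by
  induction q generalizing v c with
  | push k f q ih => simp [liftStmt, update_stks_inr, ← ih]
  | peek k f q ih => simp [liftStmt, ← ih]
  | pop k f q ih => simp [liftStmt, update_stks_inr, ← ih]
  | load f q ih => simp [liftStmt, ← ih]
  | branch f q₁ q₂ ih₁ ih₂ =>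
    simp only [liftStmt, TM2.stepAux, update_self, ih₁, ih₂]
    cases f v <;> rfl
  | goto l => simp [liftStmt]
  | halt => simp [liftStmt]

theorem stepsTo_run (i : I) (run : (S i).tm.Λ → Λ) (fin : Λ) (b : Option Bool) (s : R → Str)
    (hM : ∀ l, M (run l) = liftStmt S i run fin ((S i).tm.m l)) {t : ℕ} {c d : (S i).tm.Cfg}
    (h : StepsTo (S i).tm.step t c d) :
    StepsTo (TM2.step M) t (runCfg i run fin b s c) (runCfg i run fin b s d) := by
  induction t generalizing c with
  | zero =>
    obtain rfl : c = d := by simpa [StepsTo] using h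
    exact StepsTo.refl _
  | succ t ih =>
    obtain ⟨e, h₁, h₂⟩ := StepsTo.succ_iff.1 h
    refine StepsTo.succ_iff.2 ⟨_, ?_, ih h₂⟩
    rcases c with ⟨_ | l, v, c⟩
    · cases h₁
    · obtain rfl := Option.some.inj h₁
      simp only [runCfg, Option.elim, TM2.step, hM]
      rw [stepAux_liftStmt]
      rfl

theorem stepsTo_copyIn (i : I) (r : R) (f : Bool → (S i).tm.Γ (S i).tm.k₀) (self next : Λ)
    (hM : M self = copyIn S i r f self next) (v : ∀ i, (S i).tm.σ) (b : Option Bool) (l : Str)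
    (s : R → Str) (w : List ((S i).tm.Γ (S i).tm.k₀)) :
    StepsTo (TM2.step M) (l.length + 1)
      ⟨some self, (b, v), stks S (update s r l) (update (noStk S) i (update (fun _ => []) _ w))⟩
      ⟨some next, (none, v), stks S (update s r [])
        (update (noStk S) i (update (fun _ => []) _ (l.reverse.map f ++ w)))⟩ := by
  induction l generalizing b w with
  | nil =>
    refine StepsTo.single ?_
    simp [hM, copyIn, update_stks_inl]
  | cons a l ih =>
    have := ih (some a) (f a :: w)
    refine StepsTo.succ_iff.2 ⟨_, ?_, by simpa using this⟩
    simp [hM, copyIn, update_stks_inl, update_stks_inr]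

theorem stepsTo_copyOut (i : I) (r : R) (self next : Λ)
    (hM : M self = copyOut S i r self next) (v : ∀ i, (S i).tm.σ) (b : Option Bool)
    (w : List ((S i).tm.Γ (S i).tm.k₁)) (s : R → Str) (l : Str) :
    StepsTo (TM2.step M) (w.length + 1)
      ⟨some self, (b, v), stks S (update s r l) (update (noStk S) i (update (fun _ => []) _ w))⟩
      ⟨some next, (none, v), stks S (update s r ((w.map (S i).out).reverse ++ l)) (noStk S)⟩ := by
  induction w generalizing b l with
  | nil =>
    refine StepsTo.single ?_
    simp [hM, copyOut, update_stks_inr, noStk]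
  | cons a w ih =>
    have := ih (some ((S i).out a)) ((S i).out a :: l)
    refine StepsTo.succ_iff.2 ⟨_, ?_, by simpa using this⟩
    simp [hM, copyOut, update_stks_inl, update_stks_inr]

theorem step_popGoto (r : R) (g : Option Bool → Λ) (l : Λ) (hM : M l = popGoto S r g)
    (b : Option Bool) (s : R → Str) :
    TM2.step M (cfg l b s) = some (cfg (g (s r).head?) (s r).head? (update s r (s r).tail)) := by
  simp [hM, popGoto, cfg, update_stks_inl]

/-- Induction on the execution. The machine `M` is arbitrary as long as it contains the code of `p`
at the labels `e`, and the exit `x` varies, since the code of a part exits to the next part or back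
to the head of a loop. The final buffer is left unspecified because every read overwrites it. -/
theorem stepsTo_code {p : Prog R I} {s s' : R → Str} {t : ℕ} (h : Exec S p s s' t)
    (e : Lab S p → Λ) (x : Λ) (hM : ∀ l, M (e l) = code S p e x l) (b : Option Bool) :
    ∃ b', StepsTo (TM2.step M) t (cfg (e (entry S p)) b s) (cfg x b' s') := by
  induction h generalizing x b with
  | skip s =>
    refine ⟨b, StepsTo.single (congrArg some ?_)⟩
    rw [hM]
    simp [code]
  | push r a s =>
    refine ⟨b, StepsTo.single (congrArg some ?_)⟩
    rw [hM]
    simp [code, update_stks_inl]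
  | @cases_nil r _ _ _ s _ _ h₀ h ih =>
    obtain ⟨b', h'⟩ := ih (fun l => e (some (.inr (.inr l)))) x
      (fun l => hM _) none
    refine ⟨b', StepsTo.succ_iff.2 ⟨_, step_popGoto M _ _ _ (hM none) _ _, ?_⟩⟩
    have e₁ : update s r [] = s := by rw [← h₀, update_eq_self]
    rw [h₀, List.tail_nil, e₁]
    exact h'
  | @cases_false r _ _ _ _ _ _ _ h₀ h ih =>
    obtain ⟨b', h'⟩ := ih (fun l => e (some (.inl l))) x
      (fun l => hM _) (some false)
    refine ⟨b', StepsTo.succ_iff.2 ⟨_, step_popGoto M _ _ _ (hM none) _ _, ?_⟩⟩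
    rw [h₀]
    exact h'
  | cases_true h₀ h ih =>
    obtain ⟨b', h'⟩ := ih (fun l => e (some (.inr (.inl l)))) x
      (fun l => hM _) (some true)
    refine ⟨b', StepsTo.succ_iff.2 ⟨_, step_popGoto M _ _ _ (hM none) _ _, ?_⟩⟩
    rw [h₀]
    exact h'
  | @seq p q _ _ _ _ _ _ _ ih₁ ih₂ =>
    obtain ⟨b₁, h₁⟩ := ih₁ (fun l => e (.inl l)) (e (.inr (entry S q)))
      (fun l => hM _) b
    obtain ⟨b₂, h₂⟩ := ih₂ (fun l => e (.inr l)) x (fun l => hM _) b₁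
    exact ⟨b₂, h₁.trans h₂⟩
  | loop_nil h₀ =>
    refine ⟨none, StepsTo.single ?_⟩
    refine (step_popGoto M _ _ _ (hM none) _ _).trans ?_
    rw [h₀]
    change some (cfg x none (update _ _ [])) = _
    rw [← h₀, update_eq_self]
  | loop_false h₀ _ _ ih₁ ih₂ =>
    obtain ⟨b₁, h₁⟩ := ih₁ (fun l => e (some (.inl l))) (e none)
      (fun l => hM _) (some false)
    obtain ⟨b₂, h₂⟩ := ih₂ e x hM b₁
    refine ⟨b₂, ((StepsTo.single ?_).trans h₁).trans h₂⟩
    refine (step_popGoto M _ _ _ (hM none) _ _).trans ?_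
    rw [h₀]
    rfl
  | loop_true h₀ _ _ ih₁ ih₂ =>
    obtain ⟨b₁, h₁⟩ := ih₁ (fun l => e (some (.inr l))) (e none)
      (fun l => hM _) (some true)
    obtain ⟨b₂, h₂⟩ := ih₂ e x hM b₁
    refine ⟨b₂, ((StepsTo.single ?_).trans h₁).trans h₂⟩
    refine (step_popGoto M _ _ _ (hM none) _ _).trans ?_
    rw [h₀]
    rfl
  | @call i a r o s w t hab h =>
    obtain ⟨y, rfl, h⟩ := h
    have h₁ := stepsTo_copyIn M i r (S i).inB (e (.inl 0)) (e (.inl 1)) (hM (.inl 0))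
      (init S) b (s r) s []
    have h₂ := stepsTo_copyIn M i a (S i).inA (e (.inl 1)) (e (.inr (S i).tm.main))
      (hM (.inl 1)) (init S) none (s a) (update s r []) ((s r).reverse.map (S i).inB)
    have h₃ := stepsTo_run M i (fun l => e (.inr l)) (e (.inl 2)) none
      (update (update s r []) a []) (fun l => hM _) h
    have h₄ := stepsTo_copyOut M i o (e (.inl 2)) x (hM (.inl 2)) (init S) none y
      (update (update s r []) a []) (update (update s r []) a [] o)
    refine ⟨none, ?_⟩
    -- Since `a ≠ r`, emptying `r` has left the content of `a` intact.
    have e₁ : update (update s r []) a (s a) = update s r [] := by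
      rw [← update_of_ne hab [] s, update_eq_self]
    simp only [update_eq_self, List.append_nil, e₁] at h₁ h₂ h₄
    -- `haltList` requires a halted machine to be back in its initial state, so the subroutine is
    -- ready for another call.
    have e₂ : update (init S) i (S i).tm.initialState = init S := update_eq_self _ _
    simp only [runCfg, initList_stk, haltList_stk] at h₃
    simp only [initList, haltList, e₂] at h₃
    rw [List.length_map]
    refine ((h₁.trans h₂).trans ?_).trans h₄
    exact h₃

end Prog

/-! ### From programs to polynomial-time computability -/

namespace Prog

variable {R I : Type} [DecidableEq R] [Fintype R] (S : I → Sub) [DecidableEq I] [Fintype I]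

/-- The machine that runs a program, with input and output in given registers. -/
def compile (p : Prog R I) (rin rout : R) : FinTM2 where
  K := Stack R S
  kDecidableEq := inferInstance
  kFin :=
    haveI : ∀ i, Fintype (S i).tm.K := fun i => (S i).tm.kFin
    inferInstance
  k₀ := .inl rin
  k₁ := .inl rout
  Γ := Alph R S
  Λ := Option (Lab S p)
  main := some (entry S p)
  ΛFin := haveI := fintypeLab S p; inferInstance
  σ := St S
  initialState := (none, init S)
  σFin :=
    haveI : ∀ i, Fintype (S i).tm.σ := fun i => (S i).tm.σFin
    inferInstance
  Γk₀Fin := inferInstanceAs (Fintype Bool)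
  m
    | some l => code S p some none l
    -- The halting configuration must carry the initial internal state, so the buffer is cleared
    -- first.
    | none => .load (fun v => (none, v.2)) .halt

/-- The program has to leave all registers but `rout` empty, as `haltList` demands. The machine
needs one step more than the program, for the final halt. -/
theorem polyTime_of_exec {α β : Type} {ea : α → Str} {eb : β → Str} {f : α → β} (p : Prog R I)
    (rin rout : R) (q : Polynomial ℕ)
    (h : ∀ a, ∃ t ≤ q.eval (ea a).length, Exec S p (update (fun _ => []) rin (ea a))
      (update (fun _ => []) rout (eb (f a))) t) :
    PolyTime ea eb f := by
  have key : ∀ a, ∃ t ≤ (q + 1).eval (ea a).length,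
      StepsTo (compile S p rin rout).step t (initList (compile S p rin rout) (ea a))
        (haltList (compile S p rin rout) (eb (f a))) := by
    intro a
    obtain ⟨t, ht, h⟩ := h a
    refine ⟨t + 1, by simpa using ht, ?_⟩
    obtain ⟨b, hb⟩ := stepsTo_code (compile S p rin rout).m h some none (fun _ => rfl) none
    have h₂ : StepsTo (compile S p rin rout).step 1
        (cfg none b (update (fun _ => []) rout (eb (f a))))
        ⟨none, (none, init S), stks S (update (fun _ => []) rout (eb (f a))) (noStk S)⟩ := rfl
    have e : ∀ r w, stks S (update (fun _ => []) r w) (noStk S) =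
        (update (fun _ => []) (.inl r) w : ∀ k : Stack R S, List (Alph R S k)) := by
      intro r w
      rw [← update_stks_inl]
      congr 1
      funext k
      rcases k with k | k <;> rfl
    have e₁ : initList (compile S p rin rout) (ea a) =
        cfg (some (entry S p)) none (update (fun _ => []) rin (ea a)) := by
      have := initList_stk (compile S p rin rout) (ea a)
      rw [cfg, e]
      exact congrArg (TM2.Cfg.mk (some (some (entry S p))) ((none, init S) : St S)) this
    have e₂ : haltList (compile S p rin rout) (eb (f a)) =
        ⟨none, (none, init S), stks S (update (fun _ => []) rout (eb (f a))) (noStk S)⟩ := by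
      have := haltList_stk (compile S p rin rout) (eb (f a))
      rw [e]
      exact congrArg (TM2.Cfg.mk none ((none, init S) : St S)) this
    rw [e₁, e₂]
    exact hb.trans h₂
  choose t ht h using key
  exact ⟨{  tm := compile S p rin rout
            inputAlphabet := Equiv.refl Bool
            outputAlphabet := Equiv.refl Bool
            time := q + 1
            outputsFun := fun a =>
              { steps := t a
                evals_in_steps := by
                  exact (congrArg (fun l => (flip bind (compile S p rin rout).step)^[t a]
                      (some (initList (compile S p rin rout) l))) (List.map_id (ea a))).trans
                    (Eq.trans (h a) (congrArg (fun l => some (haltList (compile S p rin rout) l))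
                      (List.map_id (eb (f a))).symm))
                steps_le_m := ht a } }⟩

end Prog

/-! ## The length of the output -/

/-- A bound for the number of symbols that a statement pushes. -/
def pushes {K : Type} {Γ : K → Type} {Λ σ : Type} : TM2.Stmt Γ Λ σ → ℕ
  | .push _ _ q => pushes q + 1
  | .peek _ _ q => pushes q
  | .pop _ _ q => pushes q
  | .load _ q => pushes q
  | .branch _ q₁ q₂ => pushes q₁ + pushes q₂
  | .goto _ => 0
  | .halt => 0

theorem length_stepAux_le {K : Type} [DecidableEq K] {Γ : K → Type} {Λ σ : Type}
    (q : TM2.Stmt Γ Λ σ) (v : σ) (s : ∀ k, List (Γ k)) (k : K) :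
    ((TM2.stepAux q v s).stk k).length ≤ (s k).length + pushes q := by
  induction q generalizing v s with
  | push k' f q ih =>
    refine (ih _ _).trans ?_
    by_cases h : k = k'
    · subst h
      simp only [update_self, List.length_cons, pushes]
      omega
    · simp only [update_of_ne h, pushes]
      omega
  | peek k' f q ih => exact ih _ _
  | pop k' f q ih =>
    refine (ih _ _).trans ?_
    by_cases h : k = k'
    · subst h
      simp only [update_self, List.length_tail, pushes]
      omega
    · simp only [update_of_ne h, pushes]
      omega
  | load f q ih => exact ih _ _
  | branch f q₁ q₂ ih₁ ih₂ =>
    have h₁ := ih₁ v s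
    have h₂ := ih₂ v s
    simp only [TM2.stepAux, pushes]
    cases f v <;> simp only [cond] <;> omega
  | goto l => simp [pushes]
  | halt => simp [pushes]

/-- One step runs one statement and so pushes at most `c` symbols. A time bound thereby yields a
bound for the length of the output. -/
theorem StepsTo.length_le (tm : FinTM2) {c : ℕ} (hc : ∀ l, pushes (tm.m l) ≤ c) {t : ℕ}
    {a b : tm.Cfg} (h : StepsTo tm.step t a b) (k : tm.K) :
    (b.stk k).length ≤ (a.stk k).length + c * t := by
  induction t generalizing a with
  | zero =>
    obtain rfl : a = b := by simpa [StepsTo] using h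
    simp
  | succ t ih =>
    obtain ⟨d, h₁, h₂⟩ := StepsTo.succ_iff.1 h
    have h₃ := ih h₂
    rcases a with ⟨_ | l, v, s⟩
    · cases h₁
    · obtain rfl := Option.some.inj h₁
      have h₄ := length_stepAux_le (tm.m l) v s k
      have := hc l
      rw [Nat.mul_succ]
      simp only at h₃ h₄ ⊢
      omega

theorem exists_pushes_le (tm : FinTM2) : ∃ c, ∀ l, pushes (tm.m l) ≤ c := by
  have := tm.ΛFin
  exact ⟨∑ l, pushes (tm.m l), fun l =>
    Finset.single_le_sum (f := fun l => pushes (tm.m l)) (fun _ _ => Nat.zero_le _)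
      (Finset.mem_univ l)⟩

/-- A polynomial-time computable function as a subroutine, with a polynomial that bounds both the
running time and the length of the output. -/
theorem PolyTime.exists_sub {α β Γ : Type} [Fintype Γ] {ea : α → List Γ} {eb : β → Str}
    {f : α → β} (h : PolyTime ea eb f) (cA cB : Bool → Γ) :
    ∃ (S : Sub) (P : Polynomial ℕ), ∀ a u v, ea a = u.map cA ++ v.map cB →
      (eb (f a)).length ≤ P.eval (u.length + v.length) ∧
      ∃ t ≤ P.eval (u.length + v.length), S.Outputs u v (eb (f a)) t := by
  obtain ⟨M⟩ := h
  obtain ⟨c, hc⟩ := exists_pushes_le M.tm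
  -- With n the input length, the output has length at most n + c · time; one further summand
  -- `M.time` lets the same polynomial bound the running time.
  refine ⟨⟨M.tm, fun b => M.inputAlphabet.symm (cA b), fun b => M.inputAlphabet.symm (cB b),
    M.outputAlphabet⟩, .X + (.C c + 1) * M.time, fun a u v hin => ?_⟩
  obtain ⟨⟨t, ht⟩, htm⟩ := M.outputsFun a
  have hlen : (ea a).length = u.length + v.length := by simp [hin]
  have ht' : StepsTo M.tm.step t (initList M.tm ((ea a).map M.inputAlphabet.symm))
    (haltList M.tm ((eb (f a)).map M.outputAlphabet.symm)) := ht
  have hout := ht'.length_le M.tm hc M.tm.k₁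
  have hin' : ((initList M.tm ((ea a).map M.inputAlphabet.symm)).stk M.tm.k₁).length ≤
      (ea a).length := by
    rw [initList_stk]
    -- Input and output stack may coincide, and then the output stack initially holds the input.
    by_cases h : M.tm.k₁ = M.tm.k₀
    · have : ∀ (k : M.tm.K) (e : k = M.tm.k₀) (w : List (M.tm.Γ M.tm.k₀)),
          (update (fun _ => []) M.tm.k₀ w k : List (M.tm.Γ k)).length ≤ w.length := by
        rintro k rfl w; simp
      simpa using this _ h ((ea a).map M.inputAlphabet.symm)
    · simp [h]
  rw [haltList_stk, update_self, List.length_map] at hout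
  simp only at htm
  rw [hlen] at htm hin'
  have hct : c * t ≤ c * M.time.eval (u.length + v.length) := Nat.mul_le_mul_left _ htm
  simp only [Polynomial.eval_add, Polynomial.eval_mul, Polynomial.eval_X, Polynomial.eval_C,
    add_mul, one_mul]
  refine ⟨by omega, t, by omega, (eb (f a)).map M.outputAlphabet.symm, by simp, ?_⟩
  simpa [hin, Function.comp_def] using ht'

/-! ### Calculus of running-time bounds -/

namespace Prog

variable {R I : Type} [DecidableEq R] {S : I → Sub}

variable (S) in
/-- The program leads from one state to the other within the given time. -/
def Runs (p : Prog R I) (s s' : R → Str) (T : ℕ) : Prop :=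
  ∃ t ≤ T, Exec S p s s' t

namespace Runs

variable {p q p₀ p₁ pn : Prog R I} {s s' s'' : R → Str} {T T' : ℕ} {r : R} {l : Str}

theorem mono (h : Runs S p s s' T) (hT : T ≤ T') : Runs S p s s' T' :=
  let ⟨t, ht, h⟩ := h
  ⟨t, ht.trans hT, h⟩

theorem congr (h : Runs S p s s' T) (hs : s' = s'') (hT : T ≤ T') : Runs S p s s'' T' :=
  hs ▸ h.mono hT

theorem skip (s : R → Str) : Runs S .skip s s 1 := ⟨1, le_rfl, .skip s⟩

theorem push (r : R) (b : Bool) (s : R → Str) :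
    Runs S (.push r b) s (update s r (b :: s r)) 1 := ⟨1, le_rfl, .push r b s⟩

theorem seq (h : Runs S p s s' T) (h' : Runs S q s' s'' T') :
    Runs S (.seq p q) s s'' (T + T') := by
  obtain ⟨t, ht, h⟩ := h
  obtain ⟨t', ht', h'⟩ := h'
  exact ⟨t + t', by omega, .seq h h'⟩

theorem cases_nil (hr : s r = []) (h : Runs S pn s s' T) :
    Runs S (.cases r p₀ p₁ pn) s s' (T + 1) := by
  obtain ⟨t, ht, h⟩ := h
  exact ⟨t + 1, by omega, .cases_nil hr h⟩

theorem cases_false (hr : s r = false :: l) (h : Runs S p₀ (update s r l) s' T) :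
    Runs S (.cases r p₀ p₁ pn) s s' (T + 1) := by
  obtain ⟨t, ht, h⟩ := h
  exact ⟨t + 1, by omega, .cases_false hr h⟩

theorem cases_true (hr : s r = true :: l) (h : Runs S p₁ (update s r l) s' T) :
    Runs S (.cases r p₀ p₁ pn) s s' (T + 1) := by
  obtain ⟨t, ht, h⟩ := h
  exact ⟨t + 1, by omega, .cases_true hr h⟩

theorem cases_cons {b : Bool} (hr : s r = b :: l)
    (h : Runs S (bif b then p₁ else p₀) (update s r l) s' T) :
    Runs S (.cases r p₀ p₁ pn) s s' (T + 1) := by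
  cases b
  · exact cases_false hr h
  · exact cases_true hr h

theorem loop_nil (hr : s r = []) : Runs S (.loop r p₀ p₁) s s 1 := ⟨1, le_rfl, .loop_nil hr⟩

theorem loop_cons {b : Bool} (hr : s r = b :: l)
    (h : Runs S (bif b then p₁ else p₀) (update s r l) s' T)
    (h' : Runs S (.loop r p₀ p₁) s' s'' T') :
    Runs S (.loop r p₀ p₁) s s'' (1 + T + T') := by
  obtain ⟨t, ht, h⟩ := h
  obtain ⟨t', ht', h'⟩ := h'
  cases b
  · exact ⟨1 + t + t', by omega, .loop_false hr h h'⟩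
  · exact ⟨1 + t + t', by omega, .loop_true hr h h'⟩

end Runs

/-! ### Moving, comparing and clearing registers -/

/-- Push a bit to several registers. -/
def pushAll (os : List R) (b : Bool) : Prog R I :=
  os.foldr (fun o p => seq (push o b) p) skip

/-- Put a string on top of several registers. -/
def pushed (s : R → Str) (os : List R) (u : Str) : R → Str :=
  fun k => if k ∈ os then u ++ s k else s k

theorem runs_pushAll {os : List R} (h : os.Nodup) (b : Bool) (s : R → Str) :
    Runs S (pushAll os b) s (pushed s os [b]) (os.length + 1) := by
  induction os generalizing s with
  | nil => exact (Runs.skip s).congr (by funext k; simp [pushed]) (by simp)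
  | cons o os ih =>
    rw [List.nodup_cons] at h
    refine ((Runs.push o b s).seq (ih h.2 _)).congr ?_ (by simp; omega)
    funext k
    by_cases hk : k = o
    · subst hk; simp [pushed, h.1]
    · simp [pushed, hk]

/-- Move a register, reversed, on top of several other registers. -/
def move (r : R) (os : List R) : Prog R I :=
  loop r (pushAll os false) (pushAll os true)

theorem runs_move {r : R} {os : List R} (h : os.Nodup) (hr : r ∉ os) (s : R → Str) :
    Runs S (move r os) s (pushed (update s r []) os (s r).reverse)
      ((s r).length * (os.length + 2) + 1) := by
  generalize hl : s r = l
  induction l generalizing s with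
  | nil =>
    refine (Runs.loop_nil hl).congr ?_ (by simp)
    funext k
    by_cases hk : k = r
    · subst hk; simp [pushed, hl]
    · simp [pushed, hk]
  | cons b l ih =>
    have h₁ : Runs S (bif b then pushAll os true else pushAll os false) (update s r l)
        (pushed (update s r l) os [b]) (os.length + 1) := by
      cases b
      · exact runs_pushAll h _ _
      · exact runs_pushAll h _ _
    refine (Runs.loop_cons hl h₁ (ih _ (by simp [pushed, hr]))).congr ?_ ?_
    · funext k
      by_cases hk : k = r
      · subst hk; simp [pushed, hr]
      · by_cases ho : k ∈ os <;> simp [pushed, hk, ho]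
    · rw [List.length_cons]
      ring_nf
      omega

/-- Compare two registers bit by bit. -/
def compare (a b d : R) : Prog R I :=
  seq (loop a (cases b skip (push d true) (push d true)) (cases b (push d true) skip (push d true)))
    (loop b (push d true) (push d true))

theorem runs_loop_push {b d : R} (hbd : b ≠ d) (s : R → Str) :
    Runs S (loop b (push d true) (push d true)) s
      (update (update s b []) d (List.replicate (s b).length true ++ s d))
      ((s b).length * 2 + 1) := by
  generalize hl : s b = l
  induction l generalizing s with
  | nil =>
    refine (Runs.loop_nil hl).congr ?_ (by simp)
    funext k
    by_cases hk : k = d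
    · subst hk; simp
    · by_cases hk' : k = b
      · subst hk'; simp [hk, hl]
      · simp [hk, hk']
  | cons c l ih =>
    have h₁ : Runs S (bif c then push d true else push d true) (update s b l)
        (update (update s b l) d (true :: s d)) 1 := by
      have := Runs.push (S := S) d true (update s b l)
      rw [update_of_ne hbd.symm] at this
      cases c <;> exact this
    refine (Runs.loop_cons hl h₁ (ih _ (by simp [hbd]))).congr ?_ ?_
    · funext k
      by_cases hk : k = d
      · subst hk; simp [List.replicate_succ']
      · by_cases hk' : k = b
        · subst hk'; simp [hk]
        · simp [hk, hk']
    · rw [List.length_cons]; omega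

/-- Every position at which the registers differ, including those beyond the end of the shorter one,
adds a bit to `d`. -/
theorem runs_compare {a b d : R} (hab : a ≠ b) (had : a ≠ d) (hbd : b ≠ d) (s : R → Str)
    (hd : s d = []) :
    ∃ l, (l = [] ↔ s a = s b) ∧ l.length ≤ (s a).length + (s b).length ∧
      Runs S (compare a b d) s (update (update (update s a []) b []) d l)
        (5 * ((s a).length + (s b).length) + 2) := by
  -- For the induction, `d` may already hold bits `e` from earlier positions.
  suffices ∀ u v e, s a = u → s b = v → s d = e →
      ∃ l, (l = [] ↔ u = v ∧ e = []) ∧ l.length ≤ u.length + v.length + e.length ∧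
      Runs S (compare a b d) s (update (update (update s a []) b []) d l)
        (5 * (u.length + v.length) + 2) by
    simpa [hd] using this _ _ _ rfl rfl rfl
  clear hd
  intro u v e hu hv he
  induction u generalizing s v e with
  | nil =>
    refine ⟨List.replicate v.length true ++ e, by cases v <;> simp [List.replicate_succ],
      by simp, ((Runs.loop_nil hu).seq (runs_loop_push hbd s)).congr ?_ (by simp [hv]; omega)⟩
    funext k
    by_cases hk : k = d
    · subst hk; simp [he, hv]
    · by_cases hk' : k = b
      · subst hk'; simp [hk]
      · by_cases hk'' : k = a
        · subst hk''; simp [hk, hk', hu]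
        · simp [hk, hk', hk'']
  | cons c u ih =>
    have key : ∃ (v' e' : Str), v'.length ≤ v.length ∧ (v' = v.tail) ∧
        e'.length + v'.length ≤ e.length + v.length + 1 ∧
        (e' = [] ↔ v.head? = some c ∧ e = []) ∧
        Runs S (bif c then cases b (push d true) skip (push d true) else
          cases b skip (push d true) (push d true)) (update s a u)
          (update (update (update s a u) b v') d e') 2 := by
      have hb : update s a u b = v := by simp [hab.symm, hv]
      have hd : ∀ l, update (update s a u) b l d = e := by
        intro l; simp [had.symm, hbd.symm, he]
      have hd' : update s a u d = e := by simp [had.symm, he]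
      have hp : ∀ l, Runs S (push d true) (update (update s a u) b l)
          (update (update (update s a u) b l) d (true :: e)) 1 := by
        intro l
        have := Runs.push (S := S) d true (update (update s a u) b l)
        rwa [hd] at this
      have hs : ∀ l, Runs S skip (update (update s a u) b l)
          (update (update (update s a u) b l) d e) 1 := by
        intro l
        refine (Runs.skip _).congr ?_ le_rfl
        conv_rhs => rw [← hd l, update_eq_self]
      rcases v with _ | ⟨c', v⟩
      · refine ⟨[], true :: e, le_rfl, rfl, by simp, by simp, ?_⟩
        have := hp []
        rw [← hb, update_eq_self] at this
        rw [← hb, update_eq_self]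
        cases c <;> exact Runs.cases_nil hb this
      · cases c <;> cases c'
        · exact ⟨v, e, by simp, rfl, by simp; omega, by simp, Runs.cases_false hb (hs v)⟩
        · exact ⟨v, true :: e, by simp, rfl, by simp; omega, by simp, Runs.cases_true hb (hp v)⟩
        · exact ⟨v, true :: e, by simp, rfl, by simp; omega, by simp, Runs.cases_false hb (hp v)⟩
        · exact ⟨v, e, by simp, rfl, by simp; omega, by simp, Runs.cases_true hb (hs v)⟩
    obtain ⟨v', e', hv', hvt, he', hiff, hrun⟩ := key
    obtain ⟨l, hl, hlen, t, ht, hl'⟩ := ih (update (update (update s a u) b v') d e') v' e'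
      (by simp [hab, had]) (by simp [hbd]) (by simp)
    refine ⟨l, ?_, by simp; omega, ?_⟩
    · rw [hl, hiff, hvt]
      rcases v with _ | ⟨c', v⟩
      · simp
      · simp only [List.tail_cons, List.head?_cons, Option.some.injEq, List.cons.injEq]
        constructor
        · rintro ⟨rfl, rfl, rfl⟩; simp
        · rintro ⟨⟨rfl, rfl⟩, rfl⟩; simp
    · cases hl' with
      | seq h₁ h₂ =>
        refine (Runs.seq (Runs.loop_cons hu hrun ⟨_, le_rfl, h₁⟩) ⟨_, le_rfl, h₂⟩).congr ?_ ?_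
        · funext k
          by_cases hk : k = d
          · subst hk; simp
          · by_cases hk' : k = b
            · subst hk'; simp [hk]
            · by_cases hk'' : k = a
              · subst hk''; simp [hk, hk']
              · simp [hk, hk', hk'']
        · simp only [List.length_cons]; omega

/-- Empty several registers. -/
def clear (rs : List R) : Prog R I :=
  rs.foldr (fun r p => seq (move r []) p) skip

theorem runs_clear (rs : List R) (s : R → Str) (n : ℕ) (h : ∀ r, (s r).length ≤ n) :
    Runs S (clear rs) s (fun k => if k ∈ rs then [] else s k) (rs.length * (2 * n + 1) + 1) := by
  induction rs generalizing s with
  | nil => exact (Runs.skip s).congr (by simp) (by simp)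
  | cons r rs ih =>
    have hlen := h r
    refine ((runs_move List.nodup_nil (by simp) s).seq (ih _ ?_)).congr ?_ ?_
    · intro k
      by_cases hk : k = r
      · subst hk; simp [pushed]
      · simpa [pushed, hk] using h k
    · funext k
      by_cases hk : k = r
      · subst hk; simp [pushed]
      · simp [pushed, hk]
    · simp only [List.length_nil, List.length_cons]
      ring_nf
      omega

/-! ### Reading the index of a variable -/

/-- Read the code of the index of a variable from a register, and push the bits of the index to
other registers. Malformed codes are reported in the register `e`. -/
def readIndex (r f e : R) (os : List R) : Prog R I :=
  let bit (b : Bool) : Prog R I := seq (pushAll os b) (push f true)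
  let body : Prog R I := cases r skip (cases r (bit false) (bit true) (push e true)) (push e true)
  seq (push f true) (loop f body body)

/-- The flag `f` is the loop condition: each round consumes it, and it is set again only after a `1`
and the bit that follows it. The final `0` of the code leaves it unset and so ends the loop. -/
theorem runs_readIndex_loop {r f e : R} {os : List R} (hos : os.Nodup) (hrf : r ≠ f)
    (hro : r ∉ os) (hfo : f ∉ os) {bit : Bool → Prog R I}
    (hbit : bit = fun b => seq (pushAll os b) (push f true)) {body : Prog R I}
    (hbody : body = cases r skip (cases r (bit false) (bit true) (push e true)) (push e true))
    (w l : Str) (s : R → Str) (hr : s r = BoolFormula.encodeIndex w ++ l) (hf : s f = []) :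
    Runs S (loop f body body) (update s f [true]) (pushed (update s r l) os w.reverse)
      ((w.length + 1) * (os.length + 5) + 1) := by
  have hs : update (update s f [true]) f [] = s := by
    rw [update_idem, ← hf, update_eq_self]
  induction w generalizing s with
  | nil =>
    simp only [BoolFormula.encodeIndex, List.cons_append, List.nil_append] at hr
    have h₁ : Runs S (bif true then body else body) (update (update s f [true]) f [])
        (update s r l) 2 := by
      rw [hs, hbody]
      exact Runs.cases_false hr (Runs.skip _)
    refine (Runs.loop_cons (by simp) h₁ (Runs.loop_nil (by simp [hrf.symm, hf]))).congr ?_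
      (by simp only [List.length_nil]; ring_nf; omega)
    funext k
    by_cases hk : k ∈ os <;> simp [pushed, hk]
  | cons b w ih =>
    simp only [BoolFormula.encodeIndex, List.cons_append] at hr
    set s₁ := update (update s r (b :: (BoolFormula.encodeIndex w ++ l))) r
      (BoolFormula.encodeIndex w ++ l) with hs₁
    have h₀ : Runs S (bit b) s₁ (update (pushed s₁ os [b]) f [true]) (os.length + 2) := by
      have := (runs_pushAll (S := S) hos b s₁).seq (Runs.push f true _)
      rw [hbit]
      refine this.congr ?_ (by omega)
      simp [pushed, hfo, hs₁, hrf.symm, hf]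
    have h₁ : Runs S (bif true then body else body) (update (update s f [true]) f [])
        (update (pushed s₁ os [b]) f [true]) (os.length + 4) := by
      rw [hs, hbody]
      refine Runs.cases_true hr (Runs.cases_cons (b := b) (l := BoolFormula.encodeIndex w ++ l)
        (by simp) ?_)
      cases b <;> exact h₀
    refine (Runs.loop_cons (by simp) h₁ (ih _ ?_ ?_ ?_)).congr ?_ ?_
    · simp [pushed, hro, hs₁]
    · simp [pushed, hfo, hs₁, hrf.symm, hf]
    · rw [update_idem, update_eq_self_iff]
      simp [pushed, hfo, hs₁, hrf.symm, hf]
    · funext k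
      by_cases hk : k = r
      · subst hk; simp [pushed, hro, hs₁]
      · by_cases ho : k ∈ os <;> simp [pushed, hk, ho, hs₁]
    · simp only [List.length_cons]
      ring_nf
      omega

theorem runs_readIndex {r f : R} (e : R) {os : List R} (hos : os.Nodup) (hrf : r ≠ f)
    (hro : r ∉ os) (hfo : f ∉ os) (w l : Str) (s : R → Str)
    (hr : s r = BoolFormula.encodeIndex w ++ l) (hf : s f = []) :
    Runs S (readIndex r f e os) s (pushed (update s r l) os w.reverse)
      ((w.length + 1) * (os.length + 5) + 2) := by
  refine ((Runs.push f true s).seq ?_).mono (Nat.add_comm _ _).le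
  rw [hf]
  exact runs_readIndex_loop hos hrf hro hfo rfl rfl w l s hr hf

/-- The behaviour on arbitrary strings, for the syntax check. Malformed input also leaves the flag
unset, so the loop stops after a single error bit. -/
theorem runs_readIndex_loop_or {r f e : R} (hrf : r ≠ f) (hef : e ≠ f) {bit : Bool → Prog R I}
    (hbit : bit = fun b => seq (pushAll [] b) (push f true)) {body : Prog R I}
    (hbody : body = cases r skip (cases r (bit false) (bit true) (push e true)) (push e true)) :
    ∀ (u : Str) (s : R → Str), s r = u → s f = [] →
      ∃ v, v.length ≤ u.length ∧ ((∃ w, u = BoolFormula.encodeIndex w ++ v ∧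
        Runs S (loop f body body) (update s f [true]) (update s r v) (5 * u.length + 5)) ∨
      Runs S (loop f body body) (update s f [true])
        (update (update s r v) e (true :: update s r v e)) (5 * u.length + 5)) := by
  have hs : ∀ s : R → Str, s f = [] → update (update s f [true]) f [] = s := by
    intro s hf
    rw [update_idem, ← hf, update_eq_self]
  have fail : ∀ (s : R → Str) (v : Str), s f = [] → ∀ {t},
      Runs S body s (update (update s r v) e (true :: update s r v e)) t →
      Runs S (loop f body body) (update s f [true])
        (update (update s r v) e (true :: update s r v e)) (1 + t + 1) := by
    intro s v hf t h
    refine Runs.loop_cons (b := true) (l := []) (by simp) ?_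
      (Runs.loop_nil (by simp [hef.symm, hrf.symm, hf]))
    rw [hs s hf]
    exact h
  intro u
  induction u using BoolFormula.decodeIndex.induct with
  | case1 v =>
    intro s hr hf
    refine ⟨v, by simp, .inl ⟨[], rfl, ?_⟩⟩
    have := runs_readIndex_loop (S := S) (e := e) List.nodup_nil hrf (by simp) (by simp) hbit
      hbody [] v s (by rw [hr]; rfl) hf
    exact this.congr (by funext k; simp [pushed]) (by simp; omega)
  | case2 b u ih =>
    intro s hr hf
    obtain ⟨v, hv, h⟩ := ih (update (update s r (b :: u)) r u) (by simp) (by simp [hrf.symm, hf])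
    have h₁ : Runs S (bif true then body else body) (update (update s f [true]) f [])
        (update (update (update s r (b :: u)) r u) f [true]) 4 := by
      rw [hs s hf, hbody]
      refine Runs.cases_true hr (Runs.cases_cons (b := b) (l := u) (by simp) ?_)
      have : Runs S (bit b) (update (update s r (b :: u)) r u)
          (update (update (update s r (b :: u)) r u) f [true]) 2 := by
        rw [hbit]
        refine ((Runs.skip _).seq (Runs.push f true _)).congr ?_ le_rfl
        simp [hrf.symm, hf]
      cases b <;> exact this
    refine ⟨v, by simp; omega, h.imp ?_ ?_⟩
    · rintro ⟨w, hw, h⟩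
      refine ⟨b :: w, by rw [hw]; rfl, (Runs.loop_cons (by simp) h₁ h).congr (by simp) ?_⟩
      simp only [List.length_cons]; omega
    · intro h
      refine (Runs.loop_cons (by simp) h₁ h).congr (by simp) ?_
      simp only [List.length_cons]; omega
  | case3 u h₁ h₂ =>
    intro s hr hf
    refine ⟨[], by simp, .inr ?_⟩
    -- Only the empty string and a lone `1` are left as malformed codes.
    rcases u with _ | ⟨_ | _, _ | ⟨b, u⟩⟩
    · refine (fail s [] hf (t := 2) ?_).mono (by omega)
      have : update s r [] = s := by rw [← hr, update_eq_self]
      rw [this, hbody]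
      exact Runs.cases_nil hr (Runs.push _ _ _)
    · exact absurd rfl (h₁ _)
    · exact absurd rfl (h₁ _)
    · refine (fail s [] hf (t := 3) ?_).mono (by omega)
      rw [hbody]
      exact Runs.cases_true hr (Runs.cases_nil (by simp) (Runs.push _ _ _))
    · exact absurd rfl (h₂ _ _)

theorem runs_readIndex_or {r f e : R} (hrf : r ≠ f) (hef : e ≠ f) (s : R → Str) (hf : s f = []) :
    ∃ v, v.length ≤ (s r).length ∧ ((∃ w, s r = BoolFormula.encodeIndex w ++ v ∧
        Runs S (readIndex r f e []) s (update s r v) (5 * (s r).length + 6)) ∨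
      Runs S (readIndex r f e []) s
        (update (update s r v) e (true :: update s r v e)) (5 * (s r).length + 6)) := by
  obtain ⟨v, hv, h⟩ := runs_readIndex_loop_or (S := S) (I := I) hrf hef rfl rfl (s r) s rfl hf
  have h₀ := Runs.push (S := S) f true s
  rw [hf] at h₀
  refine ⟨v, hv, h.imp ?_ ?_⟩
  · rintro ⟨w, hw, h⟩
    exact ⟨w, hw, (h₀.seq h).mono (by omega)⟩
  · intro h
    exact (h₀.seq h).mono (by omega)

end Prog

/-! ## Formulas as lists of tokens -/

/-- The six kinds of tokens of a formula. -/
inductive Op : Type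
  | const (b : Bool)
  | var
  | neg
  | and
  | or

/-- The three-bit codes of the kinds of tokens. -/
def Op.bits : Op → Str
  | const b => [false, false, b]
  | var => [false, true, false]
  | neg => [false, true, true]
  | and => [true, false, false]
  | or => [true, false, true]

/-- The tokens of a formula. -/
inductive Tok : Type
  | const (b : Bool)
  | var (w : Str)
  | neg
  | and
  | or

namespace Tok

/-- The kind of a token. -/
def op : Tok → Op
  | const b => .const b
  | var _ => .var
  | neg => .neg
  | and => .and
  | or => .or

/-- The bits of a token that follow its three-bit code. -/
def index : Tok → Str
  | var w => BoolFormula.encodeIndex w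
  | _ => []

/-- The code of a token. -/
def code (t : Tok) : Str := t.op.bits ++ t.index

/-- Replace a variable by a constant. -/
def subst (w : Str) (b : Bool) : Tok → Tok
  | var u => if u = w then const b else var u
  | t => t

theorem length_code_subst_le (w : Str) (b : Bool) (t : Tok) :
    (t.subst w b).code.length ≤ t.code.length := by
  cases t with
  | var u => by_cases h : u = w <;> simp [subst, h, code, op, index, Op.bits]
  | _ => exact le_rfl

end Tok

namespace BoolFormula

theorem length_encodeIndex (w : Str) : (encodeIndex w).length = 2 * w.length + 1 := by
  induction w with
  | nil => rfl
  | cons b w ih => simp [encodeIndex, ih]; omega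

/-- The tokens of a formula in postfix notation. -/
def toks : BoolFormula → List Tok
  | const b => [.const b]
  | var w => [.var w]
  | neg φ => toks φ ++ [.neg]
  | and φ ψ => toks φ ++ toks ψ ++ [.and]
  | or φ ψ => toks φ ++ toks ψ ++ [.or]

/-- Postfix notation has no brackets, so a machine can treat the code token by token, without a
stack of subformulas. -/
theorem encode_eq_flatMap (φ : BoolFormula) : φ.encode = φ.toks.flatMap Tok.code := by
  induction φ <;> simp_all [encode, toks, Tok.code, Tok.op, Tok.index, Op.bits]

/-- Replace a variable by a constant. -/
def subst (w : Str) (b : Bool) : BoolFormula → BoolFormula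
  | const c => const c
  | var u => if u = w then const b else var u
  | neg φ => neg (subst w b φ)
  | and φ ψ => and (subst w b φ) (subst w b ψ)
  | or φ ψ => or (subst w b φ) (subst w b ψ)

theorem toks_subst (w : Str) (b : Bool) (φ : BoolFormula) :
    (φ.subst w b).toks = φ.toks.map (Tok.subst w b) := by
  induction φ with
  | var u => by_cases h : u = w <;> simp [subst, toks, Tok.subst, h]
  | _ => simp_all [subst, toks, Tok.subst]

theorem encode_subst (w : Str) (b : Bool) (φ : BoolFormula) :
    (φ.subst w b).encode = (φ.toks.map (Tok.subst w b)).flatMap Tok.code := by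
  rw [encode_eq_flatMap, toks_subst]

/-- Constants have the shortest token codes. Hence all formulas of the self-reduction obey the
length bound of the first one. -/
theorem length_encode_subst_le (w : Str) (b : Bool) (φ : BoolFormula) :
    (φ.subst w b).encode.length ≤ φ.encode.length := by
  rw [encode_subst, encode_eq_flatMap, List.length_flatMap, List.length_flatMap, List.map_map]
  exact List.sum_le_sum fun t _ => Tok.length_code_subst_le w b t

theorem eval_subst (v : Str → Bool) (w : Str) (b : Bool) (φ : BoolFormula) :
    (φ.subst w b).eval v = φ.eval (update v w b) := by
  induction φ with
  | var u => by_cases h : u = w <;> simp [subst, eval, h]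
  | _ => simp_all [subst, eval]

theorem satisfiable_iff_subst (w : Str) (φ : BoolFormula) :
    φ.Satisfiable ↔ (φ.subst w false).Satisfiable ∨ (φ.subst w true).Satisfiable := by
  simp only [Satisfiable, eval_subst]
  constructor
  · rintro ⟨v, hv⟩
    have : φ.eval (update v w (v w)) = true := by rwa [update_eq_self]
    cases h : v w <;> rw [h] at this
    · exact .inl ⟨v, this⟩
    · exact .inr ⟨v, this⟩
  · rintro (⟨v, hv⟩ | ⟨v, hv⟩) <;> exact ⟨_, hv⟩

/-- For a formula without variables, this makes the value under one assignment decide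
satisfiability. -/
theorem eval_congr {v v' : Str → Bool} {φ : BoolFormula}
    (h : ∀ w, Tok.var w ∈ φ.toks → v w = v' w) : φ.eval v = φ.eval v' := by
  induction φ with
  | const b => rfl
  | var w => exact h w (by simp [toks])
  | neg φ ih => simp only [eval, ih fun w hw => h w (by simp [toks, hw])]
  | and φ ψ ih₁ ih₂ =>
    simp only [eval, ih₁ fun w hw => h w (by simp [toks, hw]),
      ih₂ fun w hw => h w (by simp [toks, hw])]
  | or φ ψ ih₁ ih₂ =>
    simp only [eval, ih₁ fun w hw => h w (by simp [toks, hw]),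
      ih₂ fun w hw => h w (by simp [toks, hw])]

theorem encode_mem_SAT {φ : BoolFormula} : φ.encode ∈ SAT ↔ φ.Satisfiable :=
  ⟨fun ⟨_, h, hs⟩ => encode_injective h ▸ hs, fun h => ⟨φ, rfl, h⟩⟩

end BoolFormula

/-! ## Loops over tokens -/

namespace Prog

variable {R I : Type} [DecidableEq R] {S : I → Sub}

/-- Run a program without loops and subroutines. -/
def run : Prog R I → (R → Str) → Option (R → Str)
  | skip, s => some s
  | push r b, s => some (update s r (b :: s r))
  | cases r p₀ p₁ pn, s =>
    match s r with
    | [] => run pn s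
    | false :: l => run p₀ (update s r l)
    | true :: l => run p₁ (update s r l)
  | seq p q, s => (run p s).bind (run q)
  | loop _ _ _, _ => none
  | call _ _ _ _, _ => none

/-- A bound for the running time of a program without loops and subroutines. -/
def cost : Prog R I → ℕ
  | skip => 1
  | push _ _ => 1
  | cases _ p₀ p₁ pn => cost p₀ + cost p₁ + cost pn + 1
  | seq p q => cost p + cost q
  | loop _ _ _ => 0
  | call _ _ _ _ => 0

/-- Straight-line code can thus be executed by computation, via `rfl` or `simp`. -/
theorem runs_of_run {p : Prog R I} {s s' : R → Str} (h : run p s = some s') :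
    Runs S p s s' (cost p) := by
  induction p generalizing s s' with
  | skip =>
    obtain rfl := Option.some.inj h
    exact .skip _
  | push r b =>
    obtain rfl := Option.some.inj h
    exact .push _ _ _
  | cases r p₀ p₁ pn ih₀ ih₁ ihn =>
    rw [run] at h
    split at h
    · exact (Runs.cases_nil ‹_› (ihn h)).mono (by simp only [cost]; omega)
    · exact (Runs.cases_false ‹_› (ih₀ h)).mono (by simp only [cost]; omega)
    · exact (Runs.cases_true ‹_› (ih₁ h)).mono (by simp only [cost]; omega)
  | seq p q ihp ihq =>
    obtain ⟨s₁, h₁, h₂⟩ := Option.bind_eq_some_iff.1 h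
    exact (ihp h₁).seq (ihq h₂)
  | loop => cases h
  | call => cases h

/-- Read three-bit codes from a register until it is empty, and act on each of them. -/
def tokLoop (r : R) (p : Op → Prog R I) (bad : Prog R I) : Prog R I :=
  loop r
    (cases r (cases r (p (.const false)) (p (.const true)) bad) (cases r (p .var) (p .neg) bad) bad)
    (cases r (cases r (p .and) (p .or) bad) bad bad)

theorem runs_tokLoop_cons {r : R} {p : Op → Prog R I} {bad : Prog R I} {s s' s'' : R → Str}
    {T T' : ℕ} {l : Str} (o : Op) (hr : s r = o.bits ++ l)
    (h : Runs S (p o) (update s r l) s' T) (h' : Runs S (tokLoop r p bad) s' s'' T') :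
    Runs S (tokLoop r p bad) s s'' (T + 3 + T') := by
  have e : ∀ l₁ l₂, update (update (update s r l₁) r l₂) r l = update s r l := by simp
  rcases o with (_ | _) | _ | _ | _ | _ <;> simp only [Op.bits, List.cons_append,
    List.nil_append] at hr <;> refine (Runs.loop_cons (T := T + 2) hr ?_ h').mono (by omega) <;>
    refine Runs.cases_cons (T := T + 1) (update_self ..) ?_ <;>
    refine Runs.cases_cons (T := T) (update_self ..) ?_ <;> rw [e] <;> exact h

/-- No token code begins if fewer than three bits are left or the first two are `11`. At least one
bit is consumed, so the loop makes progress. -/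
theorem runs_tokLoop_bad {r : R} (p : Op → Prog R I) (bad : Prog R I) {s : R → Str} {c : Bool}
    {u : Str} (hr : s r = c :: u) (h : ∀ o l, c :: u ≠ Op.bits o ++ l) :
    ∃ l, l.length ≤ u.length ∧ ∀ {s' s'' : R → Str} {T T' : ℕ}, Runs S bad (update s r l) s' T →
      Runs S (tokLoop r p bad) s' s'' T' → Runs S (tokLoop r p bad) s s'' (T + 3 + T') := by
  have e : ∀ l₁ l, update (update s r l₁) r l = update s r l := by simp
  rcases u with _ | ⟨c₂, _ | ⟨c₃, u⟩⟩
  · refine ⟨[], le_rfl, ?_⟩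
    intro s' s'' T T' hb h'
    refine (Runs.loop_cons (T := T + 1) hr ?_ h').mono (by omega)
    cases c <;> exact Runs.cases_nil (update_self ..) hb
  · refine ⟨[], by simp, ?_⟩
    intro s' s'' T T' hb h'
    refine (Runs.loop_cons (T := T + 2) hr ?_ h').mono (by omega)
    rw [← e [c₂]] at hb
    cases c <;> refine Runs.cases_cons (T := T + 1) (update_self ..) ?_ <;> cases c₂
    · exact Runs.cases_nil (by simp) hb
    · exact Runs.cases_nil (by simp) hb
    · exact Runs.cases_nil (by simp) hb
    · exact hb.mono (by omega)
  · have hc : c = true ∧ c₂ = true := by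
      cases c <;> cases c₂
      · exact absurd rfl (h (.const c₃) u)
      · cases c₃
        · exact absurd rfl (h .var u)
        · exact absurd rfl (h .neg u)
      · cases c₃
        · exact absurd rfl (h .and u)
        · exact absurd rfl (h .or u)
      · simp
    obtain ⟨rfl, rfl⟩ := hc
    refine ⟨c₃ :: u, by simp, ?_⟩
    intro s' s'' T T' hb h'
    refine (Runs.loop_cons (T := T + 1) hr ?_ h').mono (by omega)
    refine Runs.cases_cons (T := T) (update_self ..) ?_
    rw [e]
    exact hb

end Prog

/-- The registers of the decision procedure. -/
inductive Reg : Type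
  | X | Y | E | V | B | F | T | W | P₀ | Q₀ | P₁ | Q₁ | Ga | Gb | Gc | Z | D | O
  deriving DecidableEq

instance : Fintype Reg where
  elems := {.X, .Y, .E, .V, .B, .F, .T, .W, .P₀, .Q₀, .P₁, .Q₁, .Ga, .Gb, .Gc, .Z, .D, .O}
  complete r := by cases r <;> decide

namespace Prog

open Reg

variable {I : Type} {S : I → Sub}

/-! ### Evaluation -/

/-- How a token acts on the stack of truth values; all variables are false. -/
def evalOp : Op → Prog Reg I
  | .const b => push V b
  | .var => seq (readIndex E F B []) (push V false)
  | .neg => cases V (push V true) (push V false) (push B true)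
  | .and => cases V (cases V (push V false) (push V false) (push B true))
      (cases V (push V false) (push V true) (push B true)) (push B true)
  | .or => cases V (cases V (push V false) (push V true) (push B true))
      (cases V (push V true) (push V true) (push B true)) (push B true)

/-- Evaluate a formula in the register `E`. -/
def evalLoop : Prog Reg I := tokLoop E evalOp (push B true)

/-- The rest of the loop is a premise, with time `T`; so the runs on consecutive subformulas chain
without cutting a loop in two. Twenty steps per code bit are a generous bound. -/
theorem runs_evalLoop_encode (φ : BoolFormula) : ∀ {s s'' : Reg → Str} {l : Str} {T : ℕ},
    s E = φ.encode ++ l → s F = [] →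
    Runs S (I := I) evalLoop
      (update (update s E l) V (φ.eval (fun _ => false) :: s V)) s'' T →
    Runs S (I := I) evalLoop s s'' (20 * φ.encode.length + T) := by
  induction φ with
  | const b =>
    intro s s'' l T hE hF h
    refine (runs_tokLoop_cons (.const b) hE (runs_of_run rfl) h).mono ?_
    simp [BoolFormula.encode, cost, evalOp]
  | var w =>
    intro s s'' l T hE hF h
    simp only [BoolFormula.encode, List.append_assoc] at hE
    have h₁ := runs_readIndex (S := S) B List.nodup_nil (show E ≠ F by decide) (by simp) (by simp)
      w l (update s E (BoolFormula.encodeIndex w ++ l)) (by simp) (by simpa using hF)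
    refine (runs_tokLoop_cons .var hE ((h₁.seq (runs_of_run rfl)).congr ?_ le_rfl) h).mono ?_
    · funext k
      cases k <;> simp [pushed, BoolFormula.eval]
    · simp [BoolFormula.encode, cost, BoolFormula.length_encodeIndex]; omega
  | neg φ ih =>
    intro s s'' l T hE hF h
    simp only [BoolFormula.encode, List.append_assoc] at hE
    refine (ih (T := 20 * 3 + T) hE hF ?_).mono (by simp [BoolFormula.encode]; omega)
    refine (runs_tokLoop_cons .neg (l := l) (by simp [Op.bits]) (runs_of_run ?_) h).mono
      (by simp [evalOp, cost])
    cases hv : φ.eval fun _ => false <;> simp [run, evalOp, BoolFormula.eval, hv] <;>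
      funext k <;> cases k <;> simp
  | and φ ψ ih₁ ih₂ =>
    intro s s'' l T hE hF h
    simp only [BoolFormula.encode, List.append_assoc] at hE
    refine (ih₁ (T := 20 * ψ.encode.length + (20 * 3 + T)) hE hF ?_).mono
      (by simp [BoolFormula.encode]; omega)
    refine ih₂ (l := [true, false, false] ++ l) (by simp) (by simpa using hF) ?_
    refine (runs_tokLoop_cons .and (l := l) (by simp [Op.bits]) (runs_of_run ?_) h).mono
      (by simp [evalOp, cost])
    cases hv : φ.eval fun _ => false <;> cases hw : ψ.eval fun _ => false <;>
      simp [run, evalOp, BoolFormula.eval, hv, hw] <;> funext k <;> cases k <;> simp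
  | or φ ψ ih₁ ih₂ =>
    intro s s'' l T hE hF h
    simp only [BoolFormula.encode, List.append_assoc] at hE
    refine (ih₁ (T := 20 * ψ.encode.length + (20 * 3 + T)) hE hF ?_).mono
      (by simp [BoolFormula.encode]; omega)
    refine ih₂ (l := [true, false, true] ++ l) (by simp) (by simpa using hF) ?_
    refine (runs_tokLoop_cons .or (l := l) (by simp [Op.bits]) (runs_of_run ?_) h).mono
      (by simp [evalOp, cost])
    cases hv : φ.eval fun _ => false <;> cases hw : ψ.eval fun _ => false <;>
      simp [run, evalOp, BoolFormula.eval, hv, hw] <;> funext k <;> cases k <;> simp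

/-- A stack of formulas with `m` entries, followed by the string `u`, spells the same string as
some stack of formulas with `m'` entries followed by `u'`. -/
def Parses (m : ℕ) (u : Str) (m' : ℕ) (u' : Str) : Prop :=
  ∀ Φ : List BoolFormula, Φ.length = m → ∃ Φ' : List BoolFormula, Φ'.length = m' ∧
    Φ'.reverse.flatMap BoolFormula.encode ++ u' = Φ.reverse.flatMap BoolFormula.encode ++ u

theorem Parses.trans {m m' m'' : ℕ} {u u' u'' : Str} (h : Parses m u m' u')
    (h' : Parses m' u' m'' u'') : Parses m u m'' u'' := by
  intro Φ hΦ
  obtain ⟨Φ', h₁, h₂⟩ := h Φ hΦ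
  obtain ⟨Φ'', h₃, h₄⟩ := h' Φ' h₁
  exact ⟨Φ'', h₃, h₄.trans h₂⟩

/-- On arbitrary input, either an error bit is recorded or the operation mirrors a step of a postfix
parser. The stack of truth values has the height of the parser's stack of formulas. -/
theorem runs_evalOp (o : Op) (s : Reg → Str) (hF : s F = []) :
    ∃ e v b, e.length ≤ (s E).length ∧ v.length ≤ (s V).length + 1 ∧
      (b = true :: s B ∨ b = s B ∧ Parses (s V).length (o.bits ++ s E) v.length e) ∧
      Runs S (I := I) (evalOp o) s (update (update (update s E e) V v) B b)
        (5 * (s E).length + 17) := by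
  have bad : ∀ v : Str, v.length ≤ (s V).length → o ≠ .var → run (evalOp (I := I) o) s =
      some (update (update s V v) B (true :: s B)) → ∃ e v b, e.length ≤ (s E).length ∧
      v.length ≤ (s V).length + 1 ∧
      (b = true :: s B ∨ b = s B ∧ Parses (s V).length (o.bits ++ s E) v.length e) ∧
      Runs S (I := I) (evalOp o) s (update (update (update s E e) V v) B b)
        (5 * (s E).length + 17) := by
    intro v hv ho h
    refine ⟨s E, v, true :: s B, le_rfl, by omega, .inl rfl, (runs_of_run h).congr ?_ ?_⟩
    · funext k; cases k <;> simp
    · cases o <;> simp [evalOp, cost] at ho ⊢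
  have good : ∀ v : Str, v.length ≤ (s V).length + 1 → o ≠ .var →
      run (evalOp (I := I) o) s = some (update s V v) →
      Parses (s V).length (o.bits ++ s E) v.length (s E) → ∃ e v b, e.length ≤ (s E).length ∧
      v.length ≤ (s V).length + 1 ∧
      (b = true :: s B ∨ b = s B ∧ Parses (s V).length (o.bits ++ s E) v.length e) ∧
      Runs S (I := I) (evalOp o) s (update (update (update s E e) V v) B b)
        (5 * (s E).length + 17) := by
    intro v hv ho h hp
    refine ⟨s E, v, s B, le_rfl, hv, .inr ⟨rfl, hp⟩, (runs_of_run h).congr ?_ ?_⟩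
    · funext k; cases k <;> simp
    · cases o <;> simp [evalOp, cost] at ho ⊢
  -- Conjunction and disjunction together: `f` is the truth table and `C` the constructor.
  have binary : (f : Bool → Bool → Bool) → (C : BoolFormula → BoolFormula → BoolFormula) →
      (∀ φ ψ, (C φ ψ).encode = φ.encode ++ ψ.encode ++ o.bits) →
      evalOp (I := I) o = cases V
        (cases V (push V (f false false)) (push V (f false true)) (push B true))
        (cases V (push V (f true false)) (push V (f true true)) (push B true)) (push B true) →
      o ≠ .var → ∃ e v b, e.length ≤ (s E).length ∧ v.length ≤ (s V).length + 1 ∧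
      (b = true :: s B ∨ b = s B ∧ Parses (s V).length (o.bits ++ s E) v.length e) ∧
      Runs S (I := I) (evalOp o) s (update (update (update s E e) V v) B b)
        (5 * (s E).length + 17) := by
    intro f C hC ho hvar
    rcases hV : s V with _ | ⟨x, _ | ⟨y, l⟩⟩
    · rw [← hV]
      refine bad [] (by simp) hvar ?_
      simp only [ho, run, hV]
      refine congrArg some ?_
      funext k; cases k <;> simp [hV]
    · rw [← hV]
      refine bad [] (by simp) hvar ?_
      cases x <;> simp [ho, run, hV]
    · rw [← hV]
      refine good (f x y :: l) (by simp [hV]) hvar ?_ ?_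
      · cases x <;> cases y <;> simp [ho, run, hV]
      · rintro Φ hΦ
        rcases Φ with _ | ⟨ψ, _ | ⟨φ, Φ⟩⟩ <;> simp [hV] at hΦ
        exact ⟨C φ ψ :: Φ, by simp [hΦ], by simp [hC]⟩
  cases o with
  | const c =>
    refine good (c :: s V) (by simp) (by simp) rfl ?_
    rintro Φ hΦ
    exact ⟨.const c :: Φ, by simp [hΦ], by simp [BoolFormula.encode, Op.bits]⟩
  | var =>
    obtain ⟨v, hv, ⟨w, hw, h⟩ | h⟩ := runs_readIndex_or (S := S) (I := I) (show E ≠ F by decide)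
      (show B ≠ F by decide) s hF
    · refine ⟨v, false :: s V, s B, hv, by simp, .inr ⟨rfl, ?_⟩,
        (h.seq (runs_of_run rfl)).congr ?_ (by simp [cost])⟩
      · rintro Φ hΦ
        exact ⟨.var w :: Φ, by simp [hΦ], by simp [BoolFormula.encode, Op.bits, hw]⟩
      · funext k; cases k <;> simp
    · refine ⟨v, false :: s V, true :: s B, hv, by simp, .inl rfl,
        (h.seq (runs_of_run rfl)).congr ?_ (by simp [cost])⟩
      funext k; cases k <;> simp
  | neg =>
    rcases hV : s V with _ | ⟨x, l⟩
    · rw [← hV]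
      refine bad [] (by simp) (by simp) ?_
      simp only [evalOp, run, hV]
      refine congrArg some ?_
      funext k; cases k <;> simp [hV]
    · rw [← hV]
      refine good ((!x) :: l) (by simp [hV]) (by simp) ?_ ?_
      · cases x <;> simp [evalOp, run, hV]
      · rintro Φ hΦ
        rcases Φ with _ | ⟨φ, Φ⟩ <;> simp [hV] at hΦ
        exact ⟨.neg φ :: Φ, by simp [hΦ], by simp [BoolFormula.encode, Op.bits]⟩
  | and => exact binary (· && ·) .and (fun _ _ => rfl) rfl (by simp)
  | or => exact binary (· || ·) .or (fun _ _ => rfl) rfl (by simp)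

/-- Errors are never erased from `B`, so an unchanged length means that the whole string was parsed.
Started with `V` and `B` empty, a final single truth value without errors means that the input codes
one formula. -/
theorem runs_evalLoop (n : ℕ) : ∀ s : Reg → Str, (s E).length ≤ n → s F = [] →
    ∃ v b, v.length ≤ (s V).length + n ∧ b.length ≤ (s B).length + n ∧
      (s B).length ≤ b.length ∧
      (b.length = (s B).length → Parses (s V).length (s E) v.length []) ∧
      Runs S (I := I) evalLoop s (update (update (update s E []) V v) B b)
        ((5 * n + 20) * n + 1) := by
  induction n with
  | zero =>
    intro s hE _
    have hE : s E = [] := by simpa using hE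
    refine ⟨s V, s B, le_rfl, le_rfl, le_rfl, fun _ Φ hΦ => ⟨Φ, hΦ, by rw [hE]⟩,
      (Runs.loop_nil hE).congr ?_ (by simp)⟩
    funext k; cases k <;> simp [hE]
  | succ n ih =>
    intro s hE hF
    rcases hu : s E with _ | ⟨c, u⟩
    · obtain ⟨v, b, h₁, h₂, h₃, h₄, h₅⟩ := ih s (by simp [hu]) hF
      rw [hu] at h₄
      exact ⟨v, b, by omega, by omega, h₃, h₄, h₅.mono (by nlinarith)⟩
    · rw [hu, List.length_cons] at hE
      by_cases hop : ∃ o l, c :: u = Op.bits o ++ l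
      · obtain ⟨o, l, hol⟩ := hop
        have hl : l.length + 3 = u.length + 1 := by
          have := congrArg List.length hol
          cases o <;> simp [Op.bits] at this ⊢ <;> omega
        obtain ⟨e, v, b, he, hv, hb, h⟩ := runs_evalOp (S := S) (I := I) o (update s E l)
          (by simpa using hF)
        simp only [update_self, ne_eq, reduceCtorEq, not_false_eq_true, update_of_ne] at he hv hb h
        obtain ⟨v', b', h₁, h₂, h₃, h₄, h₅⟩ := ih
          (update (update (update (update s E l) E e) V v) B b) (by simp; omega) (by simpa using hF)
        simp only [update_self, ne_eq, reduceCtorEq, not_false_eq_true, update_of_ne] at h₁ h₂ h₃ h₄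
        have hbl : b.length ≤ (s B).length + 1 := by
          rcases hb with rfl | ⟨rfl, -⟩ <;> simp
        have hbl' : (s B).length ≤ b.length := by
          rcases hb with rfl | ⟨rfl, -⟩ <;> simp
        refine ⟨v', b', by omega, by omega, by omega, fun hb' => ?_,
          (runs_tokLoop_cons o (hu.trans hol) h h₅).congr ?_ ?_⟩
        · rcases hb with rfl | ⟨rfl, hp⟩
          · simp only [List.length_cons] at h₃; omega
          · rw [hol]
            exact hp.trans (h₄ hb')
        · funext k; cases k <;> simp
        · nlinarith
      · obtain ⟨l, hl, H⟩ := runs_tokLoop_bad (S := S) (I := I) evalOp (push B true) hu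
          (fun o l h => hop ⟨o, l, h⟩)
        obtain ⟨v', b', h₁, h₂, h₃, h₄, h₅⟩ := ih
          (update (update s E l) B (true :: s B)) (by simp; omega) (by simpa using hF)
        simp only [update_self, ne_eq, reduceCtorEq, not_false_eq_true, update_of_ne,
          List.length_cons] at h₁ h₂ h₃ h₄
        refine ⟨v', b', by omega, by omega, by omega, fun hb' => by omega,
          (H (Runs.push _ _ _) h₅).congr ?_ ?_⟩
        · funext k; cases k <;> simp
        · nlinarith

end Prog

namespace Prog

/-! ### Substitution -/

/-- Push a string to several registers. -/
def emit {R I : Type} (os : List R) (u : Str) : Prog R I :=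
  u.foldr (fun b p => seq (pushAll os b) p) skip

theorem runs_emit {R I : Type} [DecidableEq R] {S : I → Sub} {os : List R} (h : os.Nodup)
    (u : Str) (s : R → Str) :
    Runs S (emit os u) s (pushed s os u.reverse) (u.length * (os.length + 1) + 1) := by
  induction u generalizing s with
  | nil => exact (Runs.skip s).congr (by funext k; simp [pushed]) (by simp)
  | cons b u ih =>
    refine ((runs_pushAll h b s).seq (ih _)).congr ?_ (by simp only [List.length_cons]; ring_nf; omega)
    funext k
    by_cases hk : k ∈ os <;> simp [pushed, hk]

theorem Runs.call {R I : Type} [DecidableEq R] {S : I → Sub} {i : I} {a b o : R} {s : R → Str}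
    {u v w : Str} {t T : ℕ} (hab : a ≠ b) (ha : s a = u.reverse) (hb : s b = v.reverse)
    (h : (S i).Outputs u v w t) (ht : t ≤ T) :
    Runs S (.call i a b o) s
      (update (update (update s b []) a []) o (w.reverse ++ update (update s b []) a [] o))
      (u.length + v.length + w.length + T + 3) := by
  refine ⟨_, ?_, .call hab (w := w) (t := t) ?_⟩
  · simp only [ha, hb, List.length_reverse]; omega
  · simpa [ha, hb] using h

open Reg

variable {I : Type} {S : I → Sub}

/-- The registers that receive the results of the substitution. -/
def outs : List Reg := [P₀, Q₀, P₁, Q₁]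

/-- Push the code of the index in the register `Gb` to the output registers. -/
def emitIndex : Prog Reg I :=
  seq (loop Gb (emit outs [true, false]) (emit outs [true, true])) (emit outs [false])

theorem _root_.SemiFeasible.BoolFormula.encodeIndex_eq (w : Str) :
    BoolFormula.encodeIndex w = w.flatMap (fun b => [true, b]) ++ [false] := by
  induction w with
  | nil => rfl
  | cons b w ih => simp [BoolFormula.encodeIndex, ih]

theorem runs_emitIndex (w : Str) (s : Reg → Str) (hw : s Gb = w) :
    Runs S (I := I) emitIndex s (pushed (update s Gb []) outs (BoolFormula.encodeIndex w).reverse)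
      (w.length * 12 + 7) := by
  have ho : outs.Nodup := by decide
  suffices Runs S (I := I) (loop Gb (emit outs [true, false]) (emit outs [true, true])) s
      (pushed (update s Gb []) outs (w.flatMap fun b => [true, b]).reverse) (w.length * 12 + 1) by
    refine (this.seq (runs_emit ho [false] _)).congr ?_ (by simp [outs])
    rw [BoolFormula.encodeIndex_eq]
    funext k
    by_cases hk : k ∈ outs <;> simp [pushed, hk]
  induction w generalizing s with
  | nil =>
    refine (Runs.loop_nil hw).congr ?_ (by simp)
    funext k; cases k <;> simp [pushed, hw]
  | cons b w ih =>
    have h₁ : Runs S (I := I) (bif b then emit outs [true, true] else emit outs [true, false])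
        (update s Gb w) (pushed (update s Gb w) outs [b, true]) 11 := by
      cases b
      · exact runs_emit ho [true, false] _
      · exact runs_emit ho [true, true] _
    refine (Runs.loop_cons hw h₁ (ih _ (by simp [pushed, outs]))).congr ?_
      (by simp only [List.length_cons]; omega)
    funext k
    cases k <;> simp [pushed, outs]

/-- Copy the variable whose index comes next in the register `Y`, or replace it by the constants
if it is the variable in the register `W`. -/
def substVar : Prog Reg I :=
  let differ : Prog Reg I := seq (move D []) (seq (emit outs [false, true, false]) emitIndex)
  -- `compare` consumes its arguments: `Gb` keeps a copy of the index just read, and the double move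
  -- of `W` restores it while leaving a copy in `Gc`.
  seq (readIndex Y F B [T]) <| seq (move T [Z, Gb]) <| seq (move W [Ga]) <|
  seq (move Ga [W, Gc]) <| seq (compare Z Gc D) <|
  cases D differ differ <| seq (move Gb []) <|
  seq (emit [P₀, Q₀] [false, false, false]) (emit [P₁, Q₁] [false, false, true])

/-- The auxiliary registers are empty. -/
structure Clean (s : Reg → Str) : Prop where
  F : s F = []
  T : s T = []
  Ga : s Ga = []
  Gb : s Gb = []
  Gc : s Gc = []
  Z : s Z = []
  D : s D = []

/-- The state after results of a substitution have been pushed. -/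
def substd (s : Reg → Str) (u v : Str) : Reg → Str :=
  pushed (pushed s [P₀, Q₀] u.reverse) [P₁, Q₁] v.reverse

theorem pushed_outs (s : Reg → Str) (u : Str) : pushed s outs u.reverse = substd s u u := by
  funext k; cases k <;> simp [pushed, substd, outs]

theorem runs_substVar {u w l : Str} {s : Reg → Str} (hY : s Y = BoolFormula.encodeIndex u ++ l)
    (hW : s W = w) (hs : Clean s) :
    Runs S (I := I) substVar s (substd (update s Y l) ((Tok.var u).subst w false).code
      ((Tok.var u).subst w true).code) (60 * (u.length + w.length + 1)) := by
  obtain ⟨hF, hT, hGa, hGb, hGc, hZ, hD⟩ := hs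
  have h₁ := runs_readIndex (S := S) (I := I) B (os := [T]) (by decide) (show Y ≠ F by decide)
    (by decide) (by decide) u l s hY hF
  have h₂ : Runs S (I := I) (move T [Z, Gb]) _ (update (update (update s Y l) Z u) Gb u) _ :=
    (runs_move (by decide) (by decide) (pushed (update s Y l) [T] u.reverse)).congr (by
      funext k; cases k <;> simp [pushed, hT, hZ, hGb]) le_rfl
  have h₃ := runs_move (S := S) (I := I) (r := W) (os := [Ga]) (by decide) (by decide)
    (update (update (update s Y l) Z u) Gb u)
  have h₄ : Runs S (I := I) (move Ga [W, Gc]) _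
      (update (update (update (update s Y l) Z u) Gb u) Gc w) _ :=
    (runs_move (by decide) (by decide) (pushed (update
      (update (update (update s Y l) Z u) Gb u) W []) [Ga]
      (update (update (update s Y l) Z u) Gb u W).reverse)).congr (by
      funext k; cases k <;> simp [pushed, hGa, hGc, hW]) le_rfl
  obtain ⟨d, hd, hdl, h₅⟩ := runs_compare (S := S) (I := I) (show Z ≠ Gc by decide)
    (show Z ≠ D by decide) (show Gc ≠ D by decide)
    (update (update (update (update s Y l) Z u) Gb u) Gc w) (by simpa using hD)
  have e : ∀ d, update (update (update (update (update (update (update s Y l) Z u) Gb u) Gc w) Z [])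
      Gc []) D d = update (update (update s Y l) Gb u) D d := by
    intro d; funext k; cases k <;> simp [hZ, hGc]
  rw [e] at h₅
  simp only [update_self, ne_eq, reduceCtorEq, not_false_eq_true, update_of_ne] at hd hdl h₅
  have hdiff : ∀ d, Runs S (I := I)
      (seq (move D []) (seq (emit outs [false, true, false]) emitIndex))
      (update (update (update s Y l) Gb u) D d)
      (substd (update s Y l) (Tok.var u).code (Tok.var u).code)
      (d.length * 2 + u.length * 12 + 24) := by
    intro d
    refine ((runs_move (by decide) (by decide) _).seq ((runs_emit (by decide) _ _).seq
      (runs_emitIndex u _ (by simp [pushed, outs])))).congr ?_ ?_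
    · rw [← pushed_outs]
      funext k
      cases k <;> simp [pushed, outs, Tok.code, Tok.op, Tok.index, Op.bits, hD, hGb]
    · simp [outs]; omega
  have hsame : u = w → Runs S (I := I)
      (seq (move Gb []) (seq (emit [P₀, Q₀] [false, false, false])
        (emit [P₁, Q₁] [false, false, true])))
      (update (update (update s Y l) Gb u) D [])
      (substd (update s Y l) (Tok.const false).code (Tok.const true).code)
      (u.length * 2 + 21) := by
    rintro rfl
    refine ((runs_move (by decide) (by decide) _).seq ((runs_emit (by decide) _ _).seq
      (runs_emit (by decide) _ _))).congr ?_ ?_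
    · funext k
      cases k <;> simp [substd, pushed, Tok.code, Tok.op, Tok.index, Op.bits, hD, hGb]
    · simp
  refine (h₁.seq (h₂.seq (h₃.seq (h₄.seq (h₅.seq
    (show Runs S _ _ _ (d.length * 2 + u.length * 14 + 25) from ?_)))))).mono ?_
  · rcases d with _ | ⟨c, d⟩
    · have huw := hd.1 rfl
      simp only [Tok.subst, huw, if_true]
      have := hsame huw
      rw [huw] at this
      exact (Runs.cases_nil (by simp) this).mono (by omega)
    · have huw : u ≠ w := fun h => by simpa using hd.2 h
      simp only [Tok.subst, huw, if_false]
      refine (Runs.cases_cons (b := c) (l := d) (by simp) ?_).mono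
        (T := d.length * 2 + u.length * 12 + 24 + 1) (by simp; omega)
      rw [update_idem]
      cases c <;> exact hdiff d
  · simp [pushed, hT, hGa, hW]
    omega

/-- How a token is copied under a substitution. -/
def substOp : Op → Prog Reg I
  | .var => substVar
  | o => emit outs o.bits

/-- Substitute constants for the variable `W` in the formula `Y`. -/
def substLoop : Prog Reg I := tokLoop Y substOp skip

theorem runs_substOp {w l : Str} {s : Reg → Str} (t : Tok) (hY : s Y = t.index ++ l)
    (hW : s W = w) (hs : Clean s) {n : ℕ} (hn : t.code.length + w.length ≤ n) :
    Runs S (I := I) (substOp t.op) s (substd (update s Y l) (t.subst w false).code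
      (t.subst w true).code) (60 * n) := by
  have key : ∀ o : Op, t.code = o.bits → t.index = [] → (∀ b, t.subst w b = t) →
      Runs S (I := I) (emit outs o.bits) s (substd (update s Y l) (t.subst w false).code
      (t.subst w true).code) (60 * n) := by
    intro o ho ht hb
    have : update s Y l = s := by rw [ht] at hY; rw [← List.nil_append l, ← hY, update_eq_self]
    rw [hb, hb, this, ← pushed_outs, ho]
    refine (runs_emit (by decide) o.bits s).mono ?_
    have : o.bits.length = 3 := by cases o <;> rfl
    rw [ho] at hn
    simp [this, outs] at hn ⊢; omega
  cases t with
  | var u =>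
    refine (runs_substVar hY hW hs).mono ?_
    have := BoolFormula.length_encodeIndex u
    simp [Tok.code, Tok.op, Tok.index, Op.bits] at hn
    omega
  | const b => exact key (.const b) rfl rfl fun _ => rfl
  | neg => exact key .neg rfl rfl fun _ => rfl
  | and => exact key .and rfl rfl fun _ => rfl
  | or => exact key .or rfl rfl fun _ => rfl

theorem runs_substLoop {w : Str} {n : ℕ} (ts : List Tok) : ∀ {s : Reg → Str},
    s Y = ts.flatMap Tok.code → s W = w → Clean s → (ts.flatMap Tok.code).length + w.length ≤ n →
    Runs S (I := I) substLoop s (substd (update s Y [])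
      ((ts.map (Tok.subst w false)).flatMap Tok.code)
      ((ts.map (Tok.subst w true)).flatMap Tok.code))
      ((ts.flatMap Tok.code).length * (60 * n) + 1) := by
  induction ts with
  | nil =>
    intro s hY _ _ _
    refine (Runs.loop_nil hY).congr ?_ (by simp)
    funext k; cases k <;> simp [substd, pushed, hY]
  | cons t ts ih =>
    intro s hY hW hs hn
    rw [List.flatMap_cons, List.length_append] at hn
    rw [List.flatMap_cons, Tok.code, List.append_assoc] at hY
    obtain ⟨hF, hT, hGa, hGb, hGc, hZ, hD⟩ := hs
    have h₁ := runs_substOp (S := S) (I := I) (w := w) (l := ts.flatMap Tok.code)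
      (s := update s Y (t.index ++ ts.flatMap Tok.code)) t (by simp) (by simpa using hW)
      (by constructor <;> simpa) (n := n) (by omega)
    refine (runs_tokLoop_cons t.op hY h₁ (ih ?_ ?_ ?_ ?_)).congr ?_ ?_
    · simp [substd, pushed]
    · simpa [substd, pushed] using hW
    · constructor <;> simpa [substd, pushed]
    · omega
    · funext k
      cases k <;> simp [substd, pushed]
    · have : 3 ≤ t.code.length := by
        have : t.op.bits.length = 3 := by cases t.op <;> rfl
        simp [Tok.code, this]
      rw [List.flatMap_cons, List.length_append]
      nlinarith

end Prog

namespace Prog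

open Reg

variable {S : Fin 3 → Sub}

/-! ### The self-reduction -/

/-- Ask the selector which of two formulas to keep. -/
def query : Prog Reg (Fin 3) :=
  let second : Prog Reg (Fin 3) := seq (move D []) (seq (move P₀ []) (move P₁ [Y]))
  -- Calls consume their arguments. The candidates survive in `P₀` and `P₁`, and the first image
  -- survives in `Gc` for comparison with the choice of the selector. The empty register `E` is the
  -- dummy second argument.
  seq (call 1 Q₀ E Ga) <| seq (move Ga [T]) <| seq (move T [Ga, Gc]) <| seq (call 1 Q₁ E Gb) <|
  seq (call 2 Ga Gb Z) <| seq (compare Z Gc D) <|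
  cases D second second (seq (move P₁ []) (move P₀ [Y]))

theorem runs_query {g : Str → Str} {f : Str × Str → Str} {n m k : ℕ}
    (hg : ∀ x, x.length ≤ n → (g x).length ≤ m ∧ ∃ t ≤ m, (S 1).Outputs x [] (g x) t)
    (hf : ∀ a b, a.length ≤ m → b.length ≤ m → (f (a, b)).length ≤ k ∧
      ∃ t ≤ k, (S 2).Outputs a b (f (a, b)) t)
    {y₀ y₁ : Str} {s : Reg → Str} (h₀ : y₀.length ≤ n) (h₁ : y₁.length ≤ n) (hY : s Y = [])
    (hE : s E = []) (hP₀ : s P₀ = y₀.reverse) (hQ₀ : s Q₀ = y₀.reverse)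
    (hP₁ : s P₁ = y₁.reverse) (hQ₁ : s Q₁ = y₁.reverse) (hs : Clean s) :
    Runs S query s (update (update (update (update (update s P₀ []) Q₀ []) P₁ []) Q₁ []) Y
      (if f (g y₀, g y₁) = g y₀ then y₀ else y₁)) (20 * (n + m + k + 2)) := by
  obtain ⟨hF, hT, hGa, hGb, hGc, hZ, hD⟩ := hs
  obtain ⟨hm₀, t₀, ht₀, ho₀⟩ := hg y₀ h₀
  obtain ⟨hm₁, t₁, ht₁, ho₁⟩ := hg y₁ h₁
  obtain ⟨hk, t, ht, ho⟩ := hf _ _ hm₀ hm₁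
  set s₁ := update (update s Q₀ []) Ga (g y₀).reverse with hs₁
  set s₂ := update (update (update s Q₀ []) Ga (g y₀).reverse) Gc (g y₀).reverse with hs₂
  set s₃ := update (update s₂ Q₁ []) Gb (g y₁).reverse with hs₃
  set s₄ := update (update (update (update s Q₀ []) Q₁ []) Gc (g y₀).reverse) Z
    (f (g y₀, g y₁)).reverse with hs₄
  have r₁ : Runs S (.call 1 Q₀ E Ga) s s₁ _ :=
    (Runs.call (by decide) hQ₀ (v := []) (by simpa using hE) ho₀ ht₀).congr (by
      funext k; cases k <;> simp [hs₁, hE, hGa]) le_rfl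
  have r₂ : Runs S (move Ga [T]) s₁ _ _ := runs_move (by decide) (by decide) _
  have r₃ : Runs S (move T [Ga, Gc]) _ s₂ _ :=
    (runs_move (by decide) (by decide) (pushed (update s₁ Ga []) [T] (s₁ Ga).reverse)).congr (by
      funext k; cases k <;> simp [hs₁, hs₂, pushed, hT, hGc]) le_rfl
  have r₄ : Runs S (.call 1 Q₁ E Gb) s₂ s₃ _ :=
    (Runs.call (by decide) (by simpa [hs₂] using hQ₁) (v := []) (by simpa [hs₂] using hE)
      ho₁ ht₁).congr (by
        funext k; cases k <;> simp [hs₂, hs₃, hE, hGb]) le_rfl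
  have r₅ : Runs S (.call 2 Ga Gb Z) s₃ s₄ _ :=
    (Runs.call (by decide) (by simp [hs₃, hs₂]) (by simp [hs₃, hs₂]) ho ht).congr (by
        funext k; cases k <;> simp [hs₂, hs₃, hs₄, hGa, hGb, hZ]) le_rfl
  obtain ⟨d, hd, hdl, r₆⟩ := runs_compare (S := S) (show Z ≠ Gc by decide)
    (show Z ≠ D by decide) (show Gc ≠ D by decide) s₄ (by simpa [hs₄] using hD)
  have hZ₄ : s₄ Z = (f (g y₀, g y₁)).reverse := by simp [hs₄]
  have hG₄ : s₄ Gc = (g y₀).reverse := by simp [hs₄]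
  rw [hZ₄, hG₄, List.reverse_inj] at hd
  rw [hZ₄, hG₄, List.length_reverse, List.length_reverse] at hdl r₆
  refine (r₁.seq (r₂.seq (r₃.seq (r₄.seq (r₅.seq (r₆.seq
    (show Runs S _ _ _ (d.length * 2 + y₀.length * 3 + y₁.length * 3 + 4) from ?_))))))).mono ?_
  · rcases d with _ | ⟨c, d⟩
    · rw [if_pos (hd.1 rfl)]
      refine (Runs.cases_nil (by simp) ((runs_move (by decide) (by decide) _).seq
        (runs_move (by decide) (by decide) _))).congr ?_ ?_
      · funext k; cases k <;> simp [hs₄, pushed, hY, hP₀, hGc, hZ, hD]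
      · simp [hs₄, pushed, hP₀, hP₁]; omega
    · rw [if_neg fun h => by simpa using hd.2 h]
      refine (Runs.cases_cons (b := c) (l := d) (T := d.length * 2 + y₀.length * 3 +
        y₁.length * 3 + 3) (by simp) ?_).mono (by simp)
      rw [update_idem]
      have := (runs_move (S := S) (r := D) (os := []) (by decide) (by decide)
        (update (update (update s₄ Z []) Gc []) D d)).seq
        ((runs_move (r := P₀) (os := []) (by decide) (by decide) _).seq
        (runs_move (r := P₁) (os := [Y]) (by decide) (by decide) _))
      have := this.congr (s'' := update (update (update (update (update s P₀ []) Q₀ []) P₁ [])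
        Q₁ []) Y y₁) (T' := d.length * 2 + y₀.length * 3 + y₁.length * 3 + 3) (by
          funext k; cases k <;> simp [hs₄, pushed, hY, hP₁, hGc, hZ, hD]) (by
          simp [hs₄, pushed, hP₀, hP₁]; omega)
      cases c <;> exact this
  · simp [hs₁, pushed, hT]
    omega

/-- Eliminate the variable whose index comes next in the register `X`. -/
def eliminate : Prog Reg (Fin 3) :=
  seq (readIndex X F B [T]) <| seq (move T [W]) <| seq substLoop <| seq query (move W [])

/-- How a token acts in the self-reduction. -/
def reduceOp : Op → Prog Reg (Fin 3)
  | .var => eliminate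
  | _ => skip

/-- Eliminate all variables of the formula `X` from the formula `Y`. -/
def reduceLoop : Prog Reg (Fin 3) := tokLoop X reduceOp skip

/-- The registers other than `X` and `Y` that take part in the self-reduction are empty. -/
structure Idle (s : Reg → Str) : Prop extends Clean s where
  W : s W = []
  E : s E = []
  P₀ : s P₀ = []
  Q₀ : s Q₀ = []
  P₁ : s P₁ = []
  Q₁ : s Q₁ = []

theorem runs_eliminate {g : Str → Str} {f : Str × Str → Str} {n m k : ℕ}
    (hg : ∀ x, x.length ≤ n → (g x).length ≤ m ∧ ∃ t ≤ m, (S 1).Outputs x [] (g x) t)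
    (hf : ∀ a b, a.length ≤ m → b.length ≤ m → (f (a, b)).length ≤ k ∧
      ∃ t ≤ k, (S 2).Outputs a b (f (a, b)) t)
    {w l : Str} {φ : BoolFormula} {s : Reg → Str} (hX : s X = BoolFormula.encodeIndex w ++ l)
    (hw : w.length ≤ n) (hY : s Y = φ.encode) (hφ : φ.encode.length ≤ n) (hs : Idle s) :
    Runs S eliminate s (update (update s X l) Y
      (if f (g (φ.subst w false).encode, g (φ.subst w true).encode) = g (φ.subst w false).encode
        then φ.subst w false else φ.subst w true).encode)
      (n * (120 * n) + 20 * (n + m + k + 2) + 12 * n + 20) := by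
  obtain ⟨⟨hF, hT, hGa, hGb, hGc, hZ, hD⟩, hW, hE, hP₀, hQ₀, hP₁, hQ₁⟩ := hs
  rw [apply_ite BoolFormula.encode]
  have hl := fun b => (BoolFormula.length_encode_subst_le w b φ).trans hφ
  set y₀ := (φ.subst w false).encode with hy₀
  set y₁ := (φ.subst w true).encode with hy₁
  set s₁ := update (update s X l) W w with hs₁
  have r₁ := runs_readIndex (S := S) B (os := [T]) (by decide) (show X ≠ F by decide)
    (by decide) (by decide) w l s hX hF
  have r₂ : Runs S (move T [W]) _ s₁ _ :=
    (runs_move (by decide) (by decide) (pushed (update s X l) [T] w.reverse)).congr (by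
      funext k; cases k <;> simp [hs₁, pushed, hT, hW]) le_rfl
  -- `2 * n` bounds the formula and the index together.
  have r₃ := runs_substLoop (S := S) (n := 2 * n) φ.toks (s := s₁) (w := w)
    (by simp [hs₁, hY, BoolFormula.encode_eq_flatMap]) (by simp [hs₁])
    (by constructor <;> simpa [hs₁])
    (by rw [← BoolFormula.encode_eq_flatMap]; omega)
  rw [← BoolFormula.encode_eq_flatMap, ← BoolFormula.encode_subst, ← BoolFormula.encode_subst,
    ← hy₀, ← hy₁] at r₃
  have r₄ := runs_query (s := substd (update s₁ Y []) y₀ y₁) (y₀ := y₀) (y₁ := y₁) hg hf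
    (hl false) (hl true)
    (by simp [substd, pushed]) (by simpa [hs₁, substd, pushed])
    (by simp [hs₁, substd, pushed, hP₀]) (by simp [hs₁, substd, pushed, hQ₀])
    (by simp [hs₁, substd, pushed, hP₁]) (by simp [hs₁, substd, pushed, hQ₁])
    (by constructor <;> simpa [hs₁, substd, pushed])
  refine (r₁.seq (r₂.seq (r₃.seq (r₄.seq (runs_move (by decide) (by decide) _))))).congr ?_ ?_
  · funext k
    cases k <;> simp [hs₁, substd, pushed, hW, hP₀, hQ₀, hP₁, hQ₁]
  · have : φ.encode.length * (60 * (2 * n)) ≤ n * (120 * n) := by nlinarith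
    simp [hs₁, substd, pushed, hT]
    omega

/-- The heart of the proof. If φ is satisfiable, one of the two images lies in H, hence so does the
chosen image, and the formula kept has that image. If both images coincide, the first formula is
kept and the argument is unchanged. Conversely, a satisfying assignment of either substitution
yields one of φ. -/
theorem satisfiable_iff_select {H : Set Str} {g : Str → Str} {f : Str × Str → Str}
    (hgH : ∀ x, x ∈ SAT ↔ g x ∈ H) (hfH : ∀ a b : Str, f (a, b) ∈ ({a, b} : Set Str) ∧
      ((({a, b} : Set Str) ∩ H).Nonempty → f (a, b) ∈ H)) (w : Str) (φ : BoolFormula) :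
    φ.Satisfiable ↔ (if f (g (φ.subst w false).encode, g (φ.subst w true).encode) =
        g (φ.subst w false).encode then φ.subst w false else φ.subst w true).Satisfiable := by
  obtain ⟨h₁, h₂⟩ := hfH (g (φ.subst w false).encode) (g (φ.subst w true).encode)
  have key : φ.Satisfiable →
      f (g (φ.subst w false).encode, g (φ.subst w true).encode) ∈ H := by
    intro h
    refine h₂ ?_
    rcases (BoolFormula.satisfiable_iff_subst w φ).1 h with h | h
    · exact ⟨_, .inl rfl, (hgH _).1 (BoolFormula.encode_mem_SAT.2 h)⟩
    · exact ⟨_, .inr rfl, (hgH _).1 (BoolFormula.encode_mem_SAT.2 h)⟩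
  split_ifs with h
  · refine ⟨fun hφ => ?_, fun h => (BoolFormula.satisfiable_iff_subst w φ).2 (.inl h)⟩
    rw [← BoolFormula.encode_mem_SAT, hgH, ← h]
    exact key hφ
  · refine ⟨fun hφ => ?_, fun h => (BoolFormula.satisfiable_iff_subst w φ).2 (.inr h)⟩
    rw [← BoolFormula.encode_mem_SAT, hgH, ← h₁.resolve_left h]
    exact key hφ

/-- `X` lists the tokens of the original formula while `Y` changes. A variable met again no longer
occurs in `Y`, so both substitutions leave `Y` as it is and the repeated query is harmless. -/
theorem runs_reduceLoop {H : Set Str} {g : Str → Str} {f : Str × Str → Str} {n m k : ℕ}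
    (hgH : ∀ x, x ∈ SAT ↔ g x ∈ H) (hfH : ∀ a b : Str, f (a, b) ∈ ({a, b} : Set Str) ∧
      ((({a, b} : Set Str) ∩ H).Nonempty → f (a, b) ∈ H))
    (hg : ∀ x, x.length ≤ n → (g x).length ≤ m ∧ ∃ t ≤ m, (S 1).Outputs x [] (g x) t)
    (hf : ∀ a b, a.length ≤ m → b.length ≤ m → (f (a, b)).length ≤ k ∧
      ∃ t ≤ k, (S 2).Outputs a b (f (a, b)) t) (ts : List Tok) :
    ∀ {φ : BoolFormula} {s : Reg → Str}, s X = ts.flatMap Tok.code →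
    (ts.flatMap Tok.code).length ≤ n → s Y = φ.encode → φ.encode.length ≤ n → Idle s →
    ∃ φ' : BoolFormula, (φ.Satisfiable ↔ φ'.Satisfiable) ∧ φ'.encode.length ≤ n ∧
      (∀ w, .var w ∈ φ'.toks → .var w ∈ φ.toks ∧ .var w ∉ ts) ∧
      Runs S reduceLoop s (update (update s X []) Y φ'.encode)
        ((ts.flatMap Tok.code).length *
          (n * (120 * n) + 20 * (n + m + k + 2) + 12 * n + 23) + 1) := by
  induction ts with
  | nil =>
    intro φ s hX _ hY hφ _
    refine ⟨φ, Iff.rfl, hφ, fun w hw => ⟨hw, by simp⟩, (Runs.loop_nil hX).congr ?_ (by simp)⟩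
    funext k; cases k <;> simp [hX, hY]
  | cons t ts ih =>
    intro φ s hX hn hY hφ hs
    rw [List.flatMap_cons, List.length_append] at hn
    rw [List.flatMap_cons, Tok.code, List.append_assoc] at hX
    have hlen : t.code.length = 3 + t.index.length := by
      have : t.op.bits.length = 3 := by cases t.op <;> rfl
      simp [Tok.code, this]
    obtain ⟨⟨hF, hT, hGa, hGb, hGc, hZ, hD⟩, hW, hE, hP₀, hQ₀, hP₁, hQ₁⟩ := hs
    have step : ∃ φ₁ : BoolFormula, (φ.Satisfiable ↔ φ₁.Satisfiable) ∧ φ₁.encode.length ≤ n ∧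
        (∀ w, .var w ∈ φ₁.toks → .var w ∈ φ.toks ∧ .var w ≠ t) ∧
        Runs S (reduceOp t.op) (update s X (t.index ++ ts.flatMap Tok.code))
          (update (update s X (ts.flatMap Tok.code)) Y φ₁.encode)
          (n * (120 * n) + 20 * (n + m + k + 2) + 12 * n + 20) := by
      have easy : t.index = [] → reduceOp t.op = skip → (∀ w, .var w ≠ t) →
          ∃ φ₁ : BoolFormula, (φ.Satisfiable ↔ φ₁.Satisfiable) ∧ φ₁.encode.length ≤ n ∧
          (∀ w, .var w ∈ φ₁.toks → .var w ∈ φ.toks ∧ .var w ≠ t) ∧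
          Runs S (reduceOp t.op) (update s X (t.index ++ ts.flatMap Tok.code))
            (update (update s X (ts.flatMap Tok.code)) Y φ₁.encode)
            (n * (120 * n) + 20 * (n + m + k + 2) + 12 * n + 20) := by
        intro hi ho hv
        refine ⟨φ, Iff.rfl, hφ, fun w hw => ⟨hw, hv w⟩, ?_⟩
        rw [ho]
        refine (Runs.skip _).congr ?_ (by omega)
        rw [hi]
        funext k; cases k <;> simp [hY]
      cases t with
      | var u =>
        have hu := BoolFormula.length_encodeIndex u
        simp only [Tok.index] at hlen
        have h := runs_eliminate hg hf (w := u) (l := ts.flatMap Tok.code) (φ := φ)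
          (s := update s X ((Tok.var u).index ++ ts.flatMap Tok.code)) (by simp [Tok.index])
          (by omega) (by simpa using hY) hφ ⟨by constructor <;> simpa, by simpa, by simpa,
            by simpa, by simpa, by simpa, by simpa⟩
        rw [update_idem] at h
        refine ⟨_, satisfiable_iff_select hgH hfH u φ, ?_, ?_, h⟩
        · split_ifs <;> exact (BoolFormula.length_encode_subst_le _ _ _).trans hφ
        · have : ∀ b w, Tok.var w ∈ (φ.subst u b).toks →
              Tok.var w ∈ φ.toks ∧ Tok.var w ≠ Tok.var u := by
            intro b w hw
            rw [BoolFormula.toks_subst, List.mem_map] at hw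
            obtain ⟨t, ht, htw⟩ := hw
            cases t with
            | var v =>
              by_cases hv : v = u
              · simp [Tok.subst, hv] at htw
              · simp only [Tok.subst, hv, if_false] at htw
                rw [← htw]
                exact ⟨ht, by simpa using hv⟩
            | _ => simp [Tok.subst] at htw
          intro w hw
          split_ifs at hw <;> exact this _ w hw
      | const b => exact easy rfl rfl (by simp)
      | neg => exact easy rfl rfl (by simp)
      | and => exact easy rfl rfl (by simp)
      | or => exact easy rfl rfl (by simp)
    obtain ⟨φ₁, hsat, hlen₁, hvars, h⟩ := step
    obtain ⟨φ', hsat', hlen', hvars', h'⟩ := ih (φ := φ₁)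
      (s := update (update s X (ts.flatMap Tok.code)) Y φ₁.encode) (by simp) (by omega) (by simp)
      hlen₁ ⟨by constructor <;> simpa, by simpa, by simpa, by simpa, by simpa, by simpa, by simpa⟩
    refine ⟨φ', hsat.trans hsat', hlen', fun w hw => ?_,
      (runs_tokLoop_cons t.op hX h h').congr ?_ ?_⟩
    · obtain ⟨h₁, h₂⟩ := hvars' w hw
      obtain ⟨h₃, h₄⟩ := hvars w h₁
      exact ⟨h₃, by simp [h₄, h₂]⟩
    · funext k; cases k <;> simp
    · rw [List.flatMap_cons, List.length_append, hlen]
      generalize n * (120 * n) + 20 * (n + m + k + 2) + 12 * n = A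
      rw [Nat.add_mul]
      -- The code of the token has at least one bit, which pays for the round; `23` includes three
      -- steps for reading the kind of the token.
      have : 1 * (A + 23) ≤ (3 + t.index.length) * (A + 23) := Nat.mul_le_mul_right _ (by omega)
      omega

end Prog

namespace Prog

open Reg

/-! ### The decision procedure -/

section

variable {I : Type} {S : I → Sub}

/-- Branch on the outcome of an evaluation, with a third branch for malformed formulas. -/
def check (p₀ p₁ q : Prog Reg I) : Prog Reg I :=
  cases B q q (cases V (cases V q q p₀) (cases V q q p₁) q)

theorem runs_check {p₀ p₁ q : Prog Reg I} {s s' : Reg → Str} {T : ℕ} {b : Bool} (hB : s B = [])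
    (hV : s V = [b]) (h : Runs S (bif b then p₁ else p₀) (update s V []) s' T) :
    Runs S (check p₀ p₁ q) s s' (T + 3) := by
  refine Runs.cases_nil hB (Runs.cases_cons hV ?_)
  cases b
  · exact Runs.cases_nil (update_self ..) h
  · exact Runs.cases_nil (update_self ..) h

/-- The rejecting branch is reached in several states, depending on what has been popped. Only
register lengths matter, since `finish` clears everything. -/
theorem runs_check_bad {p₀ p₁ q : Prog Reg I} {s s' : Reg → Str} {T : ℕ}
    (hBV : ¬(s B = [] ∧ (s V).length = 1))
    (h : ∀ s₀ : Reg → Str, (∀ r, (s₀ r).length ≤ (s r).length) → Runs S q s₀ s' T) :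
    Runs S (check p₀ p₁ q) s s' (T + 3) := by
  have hle : ∀ (r₀ : Reg) (l : Str), l.length ≤ (s r₀).length → ∀ r,
      (update s r₀ l r).length ≤ (s r).length := by
    intro r₀ l hl r
    by_cases hr : r = r₀
    · subst hr; simpa
    · simp [hr]
  rcases hB : s B with _ | ⟨c, l⟩
  · rcases hV : s V with _ | ⟨c, _ | ⟨d, l⟩⟩
    · exact (Runs.cases_nil hB (Runs.cases_nil hV (h s fun _ => le_rfl))).mono (by omega)
    · exact absurd ⟨hB, by simp [hV]⟩ hBV
    · refine Runs.cases_nil hB (Runs.cases_cons (T := T + 1) hV ?_)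
      have := h (update (update s V (d :: l)) V l) (by
        rw [update_idem]; exact hle V l (by simp [hV]; omega))
      cases c <;> refine Runs.cases_cons (b := d) (update_self ..) ?_ <;> cases d <;> exact this
  · have := h (update s B l) (hle B l (by simp [hB]))
    refine (Runs.cases_cons hB (T := T) ?_).mono (by omega)
    cases c <;> exact this

/-- Clean up and give an answer. -/
def finish (b : Bool) : Prog Reg I :=
  seq (clear [X, Y, E, V, B, F, T, W, P₀, Q₀, P₁, Q₁, Ga, Gb, Gc, Z, D, O]) (push O b)

/-- Each of the eighteen registers costs at most `2 * n + 1`; two more steps end the clearing and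
push the answer. -/
theorem runs_finish (b : Bool) {s : Reg → Str} {n : ℕ} (h : ∀ r, (s r).length ≤ n) :
    Runs S (I := I) (finish b) s (update (fun _ => []) O [b]) (36 * n + 20) := by
  refine ((runs_clear _ s n h).seq (Runs.push O b _)).congr ?_ (by simp; omega)
  funext k; cases k <;> simp

end

variable {S : Fin 3 → Sub}

/-- Eliminate all variables of a formula, then evaluate it. -/
def reduceEval : Prog Reg (Fin 3) :=
  seq reduceLoop <| seq (move Y [T]) <| seq (move T [E]) <| seq evalLoop <|
  check (finish false) (finish true) (finish false)

/-- Reduce the input to a formula, check that it is well-formed, and decide whether it is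
satisfiable. -/
def decideProg : Prog Reg (Fin 3) :=
  seq (move X [T]) <| seq (call 0 T E O) <| seq (move O [X, Y, E]) <| seq evalLoop <|
  -- The first evaluation only tests the syntax, so both truth values lead on to `reduceEval`.
  check reduceEval reduceEval (finish false)

theorem runs_decideProg {H : Set Str} {h g : Str → Str} {f : Str × Str → Str} {x : Str}
    {n m k : ℕ}
    (hgH : ∀ x, x ∈ SAT ↔ g x ∈ H) (hfH : ∀ a b : Str, f (a, b) ∈ ({a, b} : Set Str) ∧
      ((({a, b} : Set Str) ∩ H).Nonempty → f (a, b) ∈ H))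
    (hh : (h x).length ≤ n ∧ ∃ t ≤ n, (S 0).Outputs x [] (h x) t)
    (hg : ∀ x, x.length ≤ n → (g x).length ≤ m ∧ ∃ t ≤ m, (S 1).Outputs x [] (g x) t)
    (hf : ∀ a b, a.length ≤ m → b.length ≤ m → (f (a, b)).length ≤ k ∧
      ∃ t ≤ k, (S 2).Outputs a b (f (a, b)) t) (b : Bool) (hb : b = true ↔ h x ∈ SAT) :
    Runs S decideProg (update (fun _ => []) X x) (update (fun _ => []) O [b])
      (4 * x.length + n * (120 * n * n + 20 * (m + k) + 40 * n + 300) + 200) := by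
  obtain ⟨hn, t, ht, ho⟩ := hh
  set y := h x with hy
  set s₀ : Reg → Str := fun _ => [] with hs₀
  set s₁ : Reg → Str := update (update (update s₀ X y) Y y) E y with hs₁
  have r₁ : Runs S (move X [T]) (update s₀ X x) (update s₀ T x.reverse) _ :=
    (runs_move (by decide) (by decide) _).congr (by
      funext k; cases k <;> simp [hs₀, pushed]) le_rfl
  have r₂ : Runs S (.call 0 T E O) (update s₀ T x.reverse) (update s₀ O y.reverse) _ :=
    (Runs.call (by decide) (update_self ..) (v := []) (by simp [hs₀]) ho ht).congr (by
      funext k; cases k <;> simp [hs₀]) le_rfl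
  have r₃ : Runs S (move O [X, Y, E]) (update s₀ O y.reverse) s₁ _ :=
    (runs_move (by decide) (by decide) _).congr (by
      funext k; cases k <;> simp [hs₀, hs₁, pushed]) le_rfl
  suffices Runs S (seq evalLoop (check reduceEval reduceEval (finish false))) s₁
      (update s₀ O [b]) (n * (120 * n * n + 20 * (m + k) + 40 * n + 280) + 170) by
    refine (r₁.seq (r₂.seq (r₃.seq this))).mono ?_
    simp only [update_self, List.length_cons, List.length_nil, List.length_reverse]
    nlinarith
  by_cases hφ : ∃ φ : BoolFormula, φ.encode = y
  · obtain ⟨φ, hφ⟩ := hφ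
    have e₁ := runs_evalLoop_encode (S := S) φ (s := s₁) (l := []) (by simp [hs₁, hφ])
      (by simp [hs₀, hs₁]) (Runs.loop_nil (by simp))
    obtain ⟨φ', hsat, hlen, hvars, e₂⟩ := runs_reduceLoop (S := S) hgH hfH hg hf φ.toks
      (φ := φ) (s := update (update s₀ X y) Y y)
      (by simp [← hφ, BoolFormula.encode_eq_flatMap])
      (by rw [← BoolFormula.encode_eq_flatMap, hφ]; exact hn) (by simp [hφ]) (by rw [hφ]; exact hn)
      ⟨by constructor <;> simp [hs₀], by simp [hs₀], by simp [hs₀], by simp [hs₀], by simp [hs₀],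
        by simp [hs₀], by simp [hs₀]⟩
    have e₃ : Runs S (move Y [T]) (update (update (update (update s₀ X y) Y y) X []) Y φ'.encode)
        (update s₀ T φ'.encode.reverse) _ :=
      (runs_move (by decide) (by decide) _).congr (by
        funext k; cases k <;> simp [hs₀, pushed]) le_rfl
    have e₄ : Runs S (move T [E]) (update s₀ T φ'.encode.reverse) (update s₀ E φ'.encode) _ :=
      (runs_move (by decide) (by decide) _).congr (by
        funext k; cases k <;> simp [hs₀, pushed]) le_rfl
    have e₅ := runs_evalLoop_encode (S := S) φ' (s := update s₀ E φ'.encode) (l := []) (by simp)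
      (by simp [hs₀]) (Runs.loop_nil (by simp))
    have hbφ : b = φ'.eval fun _ => false := by
      rw [Bool.eq_iff_iff, hb, ← hφ, BoolFormula.encode_mem_SAT, hsat]
      constructor
      · rintro ⟨v, hv⟩
        rw [← hv]
        -- A variable of `φ'` would occur in `φ` and at the same time have been eliminated, so there
        -- is none.
        refine BoolFormula.eval_congr fun w hw => absurd (hvars w hw) ?_
        rintro ⟨h₁, h₂⟩
        exact h₂ h₁
      · exact fun h => ⟨_, h⟩
    have e₆ : Runs S (check (finish false) (finish true) (finish false))
        (update (update (update s₀ E φ'.encode) E []) V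
          (φ'.eval (fun _ => false) :: update s₀ E φ'.encode V)) (update s₀ O [b])
        (36 * n + 20 + 3) := by
      refine runs_check (b := b) (by simp [hs₀]) (by simp [hs₀, hbφ]) ?_
      have : ∀ c, Runs S (finish c) (update (update (update (update s₀ E φ'.encode) E []) V
          (φ'.eval (fun _ => false) :: update s₀ E φ'.encode V)) V []) (update s₀ O [c])
          (36 * n + 20) := by
        intro c
        refine runs_finish c fun r => ?_
        cases r <;> simp [hs₀]
      cases b <;> exact this _
    have e₇ := e₂.seq (e₃.seq (e₄.seq (e₅.seq e₆)))
    refine (e₁.seq (runs_check (b := φ.eval fun _ => false) (T := n * (n * (120 * n) + 20 * (n + m + k + 2) + 12 * n + 23) + 1 +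
        (3 * n + 1 + (3 * n + 1 + (20 * n + 1 + (36 * n + 20 + 3)))))
      (by simp [hs₀, hs₁])
      (by simp [hs₀, hs₁]) ?_)).mono ?_
    · have e₈ : update (update (update s₁ E []) V ((φ.eval fun _ => false) :: s₁ V)) V [] =
          update (update s₀ X y) Y y := by
        funext k; cases k <;> simp [hs₁, hs₀]
      rw [e₈]
      have hφn : (φ.toks.flatMap Tok.code).length ≤ n := by
        rw [← BoolFormula.encode_eq_flatMap, hφ]; exact hn
      have : (φ.toks.flatMap Tok.code).length *
          (n * (120 * n) + 20 * (n + m + k + 2) + 12 * n + 23) ≤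
          n * (n * (120 * n) + 20 * (n + m + k + 2) + 12 * n + 23) :=
        Nat.mul_le_mul_right _ hφn
      have e₉ := e₇.mono (T' := n * (n * (120 * n) + 20 * (n + m + k + 2) + 12 * n + 23) + 1 +
        (3 * n + 1 + (3 * n + 1 + (20 * n + 1 + (36 * n + 20 + 3))))) (by
          simp only [update_self, List.length_cons, List.length_nil, List.length_reverse]
          omega)
      cases φ.eval fun _ => false <;> exact e₉
    · have e₀ : n * (120 * n * n + 20 * (m + k) + 40 * n + 280) =
          n * (n * (120 * n) + 20 * (n + m + k + 2) + 12 * n + 23) + n * (8 * n) + 217 * n := by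
        ring
      rw [hφ, e₀]
      omega
  · obtain ⟨v, c, h₁, h₂, h₃, h₄, e₁⟩ := runs_evalLoop (S := S) n s₁ (by simpa [hs₁] using hn)
      (by simp [hs₁, hs₀])
    have hbf : b = false := by
      rw [← Bool.not_eq_true, hb]
      rintro ⟨φ, h, -⟩
      exact hφ ⟨φ, h⟩
    rw [hbf]
    refine (e₁.seq (runs_check_bad (T := 36 * n + 20) ?_ ?_)).mono ?_
    -- No error and a single truth value would parse `y`, from the empty stack, as the code of one
    -- formula.
    · rintro ⟨hc, hv⟩
      simp only [update_self, ne_eq, reduceCtorEq, not_false_eq_true, update_of_ne] at hc hv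
      obtain ⟨Φ, hΦ, hΦ'⟩ := h₄ (by simp [hc, hs₁, hs₀]) [] (by simp [hs₁, hs₀])
      rw [hv, List.length_eq_one_iff] at hΦ
      obtain ⟨φ, rfl⟩ := hΦ
      exact hφ ⟨φ, by simpa [hs₁] using hΦ'⟩
    · intro s hs
      refine runs_finish false fun r => (hs r).trans ?_
      simp only [hs₁, hs₀, ne_eq, reduceCtorEq, not_false_eq_true, update_of_ne,
        List.length_nil, Nat.zero_add] at h₁ h₂
      cases r <;> simp [hs₁, hs₀, h₁, h₂, hn]
    · have e₀ : n * (120 * n * n + 20 * (m + k) + 40 * n + 280) =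
          (5 * n + 20) * n + n * (120 * n * n + 20 * (m + k) + 35 * n) + 260 * n := by
        ring
      rw [e₀]
      omega

end Prog

/-! ### NP is contained in P -/

theorem eval_le_eval (P : Polynomial ℕ) {a b : ℕ} (h : a ≤ b) : P.eval a ≤ P.eval b := by
  induction P using Polynomial.induction_on' with
  | add p q hp hq => simpa using add_le_add hp hq
  | monomial n c => simpa using Nat.mul_le_mul_left c (Nat.pow_le_pow_left h n)

theorem mem_classP_of_hard {H : Set Str} (hH : Hard classNP H) (hsel : PSelective H) {L : Set Str}
    (hL : L ∈ classNP) : L ∈ classP := by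
  classical
  obtain ⟨h, hh, hhL⟩ := hL
  -- The hardness of `H` is needed for SAT alone, which is in NP by the identity.
  obtain ⟨g, hg, hgH⟩ := hH SAT ⟨id, ⟨Turing.idComputableInPolyTime id⟩, fun _ => Iff.rfl⟩
  obtain ⟨f, hf, hfH⟩ := hsel
  obtain ⟨Sh, Ph, hSh⟩ := hh.exists_sub id id
  obtain ⟨Sg, Pg, hSg⟩ := hg.exists_sub id id
  obtain ⟨Sf, Pf, hSf⟩ := hf.exists_sub Sum.inl Sum.inr
  refine ⟨fun x => decide (h x ∈ SAT), ?_, fun x => by rw [decide_eq_true_iff, hhL]⟩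
  -- Bounds, in terms of the input length, for the formula codes, for their images under `g`, and
  -- for the selector on two such images; whence the factor 2.
  let N := Ph
  let M := Pg.comp N
  let K := Pf.comp (2 * M)
  refine Prog.polyTime_of_exec ![Sh, Sg, Sf] Prog.decideProg .X .O
    (4 * .X + N * (120 * N * N + 20 * (M + K) + 40 * N + 300) + 200) fun x => ?_
  have := Prog.runs_decideProg (S := ![Sh, Sg, Sf]) (h := h) (x := x) (n := N.eval x.length)
    (m := M.eval x.length) (k := K.eval x.length) hgH hfH ?_ ?_ ?_ (decide (h x ∈ SAT))
    decide_eq_true_iff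
  · obtain ⟨t, ht, h⟩ := this
    exact ⟨t, ht.trans (by simp), h⟩
  · simpa using hSh x x [] (by simp)
  · intro y hy
    obtain ⟨h₁, t, h₂, h₃⟩ := hSg y y [] (by simp)
    have : Pg.eval y.length ≤ M.eval x.length := by
      simpa [M] using eval_le_eval Pg hy
    exact ⟨h₁.trans (by simpa using this), t, h₂.trans (by simpa using this), h₃⟩
  · intro a b ha hb
    obtain ⟨h₁, t, h₂, h₃⟩ := hSf (a, b) a b rfl
    have : Pf.eval (a.length + b.length) ≤ K.eval x.length := by
      simpa [K] using eval_le_eval Pf (show a.length + b.length ≤ 2 * M.eval x.length by omega)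
    exact ⟨h₁.trans this, t, h₂.trans this, h₃⟩

/-! ## P is contained in NP -/

/-- The constant formula `d x` is satisfiable iff `d x` is true. Its code is two zeros followed by
`d x`, so the program pushes the answer first. -/
theorem classP_subset_classNP : classP ⊆ classNP := by
  rintro L ⟨d, hd, hL⟩
  obtain ⟨S, P, hS⟩ := hd.exists_sub id id
  refine ⟨fun x => (BoolFormula.const (d x)).encode, ?_, fun x => ?_⟩
  · refine Prog.polyTime_of_exec (R := Fin 3) (fun _ : Unit => S)
      (.seq (Prog.move 0 [1]) <| .seq (.call () 1 2 2) <|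
        .cases 2 (.seq (.push 0 false) <| .seq (.push 0 false) (.push 0 false))
          (.seq (.push 0 true) <| .seq (.push 0 false) (.push 0 false)) .skip) 0 0
      (4 * .X + P + 30) fun x => ?_
    obtain ⟨-, t, ht, h⟩ := hS x x [] (by simp)
    set s₀ : Fin 3 → Str := fun _ => [] with hs₀
    have r₁ : Prog.Runs (fun _ : Unit => S) (Prog.move 0 [1]) (update s₀ 0 x)
        (update s₀ 1 x.reverse) _ :=
      (Prog.runs_move (by decide) (by decide) _).congr (by
        funext k; fin_cases k <;> simp [hs₀, Prog.pushed]) le_rfl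
    have r₂ : Prog.Runs (fun _ : Unit => S) (.call () 1 2 2) (update s₀ 1 x.reverse)
        (update s₀ 2 [d x]) _ :=
      (Prog.Runs.call (by decide) (update_self ..) (v := []) (by simp [hs₀]) h ht).congr (by
        funext k; fin_cases k <;> simp [hs₀, Computability.encodeBool]) le_rfl
    refine (r₁.seq (r₂.seq (Prog.runs_of_run (s' := update s₀ 0 [false, false, d x]) ?_))).mono ?_
    · cases d x <;> simp [Prog.run, hs₀]
    · simp [Prog.cost, Computability.encodeBool]
      omega
  · rw [← hL, BoolFormula.encode_mem_SAT]
    exact ⟨fun h => ⟨fun _ => false, h⟩, fun ⟨_, h⟩ => h⟩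

end SemiFeasible

theorem mainTheorem6
    (h : ∃ H : Set SemiFeasible.Str,
      SemiFeasible.Hard SemiFeasible.classNP H ∧ SemiFeasible.PSelective H) :
    SemiFeasible.classP = SemiFeasible.classNP := by
  obtain ⟨H, hH, hsel⟩ := h
  exact Set.Subset.antisymm SemiFeasible.classP_subset_classNP
    fun _ hL => SemiFeasible.mem_classP_of_hard hH hsel hL
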